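/- For a real number $\alpha$ define its Lagrange constant $\mu(\alpha)\in(0,\infty]$ by $$\mu(\alpha)=\Bigl(\liminf_{p\in\mathbb{Z},\,q\in\mathbb{N}}|q(q\alpha-p)|\Bigr)^{-1},$$ where $\mathbb{N}=\{1,2,\dots\}$, the lower limit is taken over all pairs $(p,q)$ (along the filter of cofinite sets of pairs), and $\mu(\alpha)=\infty$ if the lower limit is $0$. The Lagrange spectrum $\mathbb{L}\subset\mathbb{R}$ is the set of all finite values $\mu(\alpha)$, $\alpha$ irrational. A maximal gap of $\mathbb{L}$ is an open interval $(a,b)$ with $a<b$, $a,b\in\mathbb{L}$ and $(a,b)\cap\mathbb{L}=\emptyset$; $a$ is then called its left endpoint. An irrational number $\alpha$ is called attainable if the inequality $$\left|\alpha-\frac pq\right|\le\frac1{\mu(\alpha)q^2}$$ holds for infinitely many pairs of integers $p$ and $q\geq 1$. A real number $\lambda\in\mathbb{L}$ is called admissible if there is an attainable irrational $\alpha$ with $\mu(\alpha)=\lambda$. A quadratic irrationality is an irrational real root of a quadratic polynomial with integer coefficients. Theorem. Let $a$ be the left endpoint of a maximal gap in the Lagrange spectrum. Then $a$ is admissible if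 and only if there exists a quadratic irrationality $\alpha$ such that $\mu(\alpha)=a$. -/

import Mathlib

open Filter

/-- The Lagrange constant `μ(α)`, the inverse of the lower limit of `|q (q α - p)|` over the
pairs `(p, q)` of an integer and a positive integer. It takes values in `[0, ∞]`, and is `∞`
exactly when the lower limit is `0`. -/
noncomputable def lagrangeConstant (α : ℝ) : ENNReal :=
  (liminf (fun x : ℤ × ℕ+ => ENNReal.ofReal |(x.2 : ℝ) * ((x.2 : ℝ) * α - (x.1 : ℝ))|)
    cofinite)⁻¹

/-- `HasLagrangeConstant α t` means that `μ(α)` is finite and equal to the real number `t`. -/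
def HasLagrangeConstant (α t : ℝ) : Prop :=
  lagrangeConstant α ≠ ⊤ ∧ (lagrangeConstant α).toReal = t

/-- The Lagrange spectrum: the finite values of `μ(α)` as `α` runs through the irrationals. -/
def lagrangeSpectrum : Set ℝ :=
  {t : ℝ | ∃ α : ℝ, Irrational α ∧ HasLagrangeConstant α t}

/-- An irrational number `α` is attainable if `|α - p / q| ≤ 1 / (μ(α) q ^ 2)` has infinitely many
solutions in integers `p` and `q ≥ 1`. -/
def IsAttainable (α : ℝ) : Prop :=
  Irrational α ∧
    {x : ℤ × ℕ+ | ENNReal.ofReal |α - (x.1 : ℝ) / (x.2 : ℝ)| ≤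
      1 / (lagrangeConstant α * ((x.2 : ℕ) : ENNReal) ^ 2)}.Infinite

/-- A real number `t` is admissible if it equals `μ(α)` for an attainable irrational `α`. -/
def IsAdmissible (t : ℝ) : Prop :=
  ∃ α : ℝ, IsAttainable α ∧ HasLagrangeConstant α t

/-- `(a, b)` is a maximal gap of the Lagrange spectrum. -/
def IsMaximalGap (a b : ℝ) : Prop :=
  a < b ∧ a ∈ lagrangeSpectrum ∧ b ∈ lagrangeSpectrum ∧ Set.Ioo a b ∩ lagrangeSpectrum = ∅

/-- A quadratic irrationality: an irrational real root of a quadratic polynomial with integer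
coefficients. -/
def IsQuadraticIrrationality (α : ℝ) : Prop :=
  Irrational α ∧ ∃ A B C : ℤ, A ≠ 0 ∧ (A : ℝ) * α ^ 2 + (B : ℝ) * α + (C : ℝ) = 0

/-! Encode an approximation `p/q` of `α` by a frame: some `g` in SL₂(ℤ) with `g ∞ = p/q`, together
with `x = g⁻¹ α` and `y = g⁻¹ ∞`. Then `|x - y|` is the reciprocal of `|q(qα - p)|`, and passing
between approximations is a Möbius map carrying one pair to the other. In geodesic terms the pairs
are visits of one orbit on the modular surface, and widths measure heights of excursions. The fixed
points of a hyperbolic matrix give a closed orbit, whose Lagrange constant is governed by the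
indefinite form `ell X v * ell Y v`.

Let `α` be attainable with constant `a`. After replacing `α` by `-α` if necessary, infinitely many
frames have width `x - y ≥ a`. They accumulate at a pair `(xb, yb)` of width exactly `a`. Returns
near this pair are shadowed by long closed orbits whose forms are almost as well bounded below as
that of `α` (`Seg.closing`). Their constants lie below `b`, so the gap forces their widths to be at
most `a` (`GapAt`).

This is rigid. If a return `S` moved `yb` to the left, concatenation with another long closed orbit
(`Closed.concat`) would have width above `a`; similarly for `S⁻¹`, provided it moves `yb` only
slightly. Since the frames have width at least `a`, infinitely often `y ≤ yb`, or else eventually `x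
≥ xb`. A return between two such frames must fix the corresponding endpoint (`Closed.eq_base`).
Conjugate fixed points determine each other, so `xb` and `yb` are the fixed points of one closed
orbit. Hence `xb` is quadratic, and the gap pins its constant to `a`.

Conversely, the form of a quadratic irrationality attains its minimum at a primitive vector. Moving
that vector to `(1, 0)` makes the value there positive, and its orbit approximates an equivalent
number with values approaching `1/a` from below. -/

namespace LagrangeGap

/-! ### Approximation values and their lower limit -/

/-- The quantity `|q (q α - p)|` whose lower limit defines the Lagrange constant. -/
noncomputable def approxVal (α : ℝ) (x : ℤ × ℕ+) : ℝ :=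
  |(x.2 : ℝ) * ((x.2 : ℝ) * α - (x.1 : ℝ))|

lemma approxVal_nonneg (α : ℝ) (x : ℤ × ℕ+) : 0 ≤ approxVal α x := abs_nonneg _

lemma lagrangeConstant_eq (α : ℝ) :
    lagrangeConstant α = (liminf (fun x => ENNReal.ofReal (approxVal α x)) cofinite)⁻¹ := rfl

lemma le_liminf_of_finite {α c : ℝ} (h : ∀ c' < c, {x | approxVal α x < c'}.Finite) :
    ENNReal.ofReal c ≤ liminf (fun x => ENNReal.ofReal (approxVal α x)) cofinite := by
  refine le_of_forall_lt fun d hd => ?_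
  obtain ⟨e, hde, hec⟩ := exists_between hd
  have hetop : e ≠ ⊤ := ne_top_of_lt hec
  refine lt_of_lt_of_le hde ?_
  refine le_liminf_of_le (by isBoundedDefault) ?_
  have hlt : e.toReal < c := (ENNReal.lt_ofReal_iff_toReal_lt hetop).1 hec
  refine (eventually_cofinite.2 ?_)
  refine (h _ hlt).subset fun x hx => ?_
  simp only [Set.mem_ofPred_eq, not_le] at hx ⊢
  exact (ENNReal.ofReal_lt_iff_lt_toReal (approxVal_nonneg _ _) hetop).1 hx

lemma liminf_le_of_infinite {α c : ℝ} (hc : 0 ≤ c)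
    (h : ∀ c' > c, {x | approxVal α x ≤ c'}.Infinite) :
    liminf (fun x => ENNReal.ofReal (approxVal α x)) cofinite ≤ ENNReal.ofReal c := by
  refine le_of_forall_gt fun d hd => ?_
  obtain ⟨e, hce, hed⟩ := exists_between hd
  have hetop : e ≠ ⊤ := ne_top_of_lt hed
  refine lt_of_le_of_lt ?_ hed
  refine liminf_le_of_frequently_le' ?_
  have hlt : c < e.toReal := (ENNReal.ofReal_lt_iff_lt_toReal hc hetop).1 hce
  refine frequently_cofinite_iff_infinite.2 ((h _ hlt).mono fun x hx => ?_)
  exact ENNReal.ofReal_le_of_le_toReal hx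

lemma infinite_approxVal_le_one {α : ℝ} (hα : Irrational α) :
    {x | approxVal α x ≤ 1}.Infinite := by
  have h := Real.infinite_rat_abs_sub_lt_one_div_den_sq_of_irrational hα
  have hinj : Function.Injective (fun q : ℚ => ((q.num, ⟨q.den, q.den_pos⟩) : ℤ × ℕ+)) := by
    intro q r hqr
    have hqr := Prod.mk.inj hqr
    exact Rat.ext hqr.1 (congrArg PNat.val hqr.2)
  refine (h.image hinj.injOn).mono ?_
  rintro _ ⟨q, hq, rfl⟩
  simp only [Set.mem_ofPred_eq, approxVal, PNat.mk_coe] at hq ⊢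
  have hd : (0 : ℝ) < q.den := by exact_mod_cast q.den_pos
  have hcast : (q : ℝ) = q.num / q.den := Rat.cast_def q
  rw [hcast] at hq
  have : (q.den : ℝ) * (q.den * α - q.num) = (α - q.num / q.den) * (q.den : ℝ) ^ 2 := by
    field_simp
  rw [this, abs_mul, abs_of_pos (by positivity : (0 : ℝ) < (q.den : ℝ) ^ 2)]
  rw [lt_div_iff₀ (by positivity)] at hq
  exact hq.le

/-- Dirichlet's theorem bounds the lower limit by 1. The resulting `1 ≤ t` later supplies the base
width at least 1 that permits absolute constants in the shadowing estimates. -/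
lemma HasLagrangeConstant.liminf_eq {α t : ℝ} (hα : Irrational α)
    (h : HasLagrangeConstant α t) :
    1 ≤ t ∧ liminf (fun x => ENNReal.ofReal (approxVal α x)) cofinite = ENNReal.ofReal t⁻¹ := by
  obtain ⟨h1, h2⟩ := h
  have hle : liminf (fun x => ENNReal.ofReal (approxVal α x)) cofinite ≤ 1 := by
    simpa using liminf_le_of_infinite zero_le_one
      fun c' hc' => (infinite_approxVal_le_one hα).mono fun x hx => le_trans hx hc'.le
  rw [lagrangeConstant_eq] at h1 h2
  set L := liminf (fun x => ENNReal.ofReal (approxVal α x)) cofinite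
  have h3 : 1 ≤ L⁻¹ := by simpa using ENNReal.inv_le_inv.2 hle
  have h4 : 1 ≤ t := by
    rw [← h2]
    simpa using ENNReal.toReal_mono h1 h3
  refine ⟨h4, ?_⟩
  rw [ENNReal.ofReal_inv_of_pos (by linarith), ← h2, ENNReal.ofReal_toReal h1, inv_inv]

lemma HasLagrangeConstant.finite_lt {α t : ℝ} (hα : Irrational α)
    (h : HasLagrangeConstant α t) {c : ℝ} (hc : c < t⁻¹) : {x | approxVal α x < c}.Finite := by
  rcases le_or_gt c 0 with hc0 | hc0
  · convert Set.finite_empty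
    ext x
    simpa using hc0.trans (approxVal_nonneg α x)
  obtain ⟨h1, h2⟩ := HasLagrangeConstant.liminf_eq hα h
  have hlt : ENNReal.ofReal c <
      liminf (fun x => ENNReal.ofReal (approxVal α x)) cofinite := by
    rw [h2, ENNReal.ofReal_lt_ofReal_iff (by positivity)]
    exact hc
  have := eventually_cofinite.1 (eventually_lt_of_lt_liminf hlt)
  refine this.subset fun x hx => ?_
  simp only [Set.mem_ofPred_eq, not_lt] at hx ⊢
  exact ENNReal.ofReal_le_ofReal hx.le

lemma exists_hasLagrangeConstant {α c : ℝ} (hc : 0 < c)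
    (h : ∀ c' < c, {x | approxVal α x < c'}.Finite) :
    ∃ t, HasLagrangeConstant α t ∧ t ≤ c⁻¹ := by
  have h1 := le_liminf_of_finite h
  have h2 : lagrangeConstant α ≤ ENNReal.ofReal c⁻¹ := by
    rw [lagrangeConstant_eq, ENNReal.ofReal_inv_of_pos hc]
    exact ENNReal.inv_le_inv.2 h1
  have h3 : lagrangeConstant α ≠ ⊤ := ne_top_of_le_ne_top ENNReal.ofReal_ne_top h2
  refine ⟨_, ⟨h3, rfl⟩, ?_⟩
  exact ENNReal.toReal_le_of_le_ofReal (by positivity) h2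

lemma HasLagrangeConstant.inv_le {α t c : ℝ} (hα : Irrational α) (ht : HasLagrangeConstant α t)
    (hc : 0 < c) (h : ∀ c' > c, {x | approxVal α x ≤ c'}.Infinite) : c⁻¹ ≤ t := by
  obtain ⟨h1, h2⟩ := HasLagrangeConstant.liminf_eq hα ht
  have h3 := liminf_le_of_infinite hc.le h
  rw [h2, ENNReal.ofReal_le_ofReal_iff hc.le] at h3
  exact inv_le_of_inv_le₀ (by linarith) h3

lemma HasLagrangeConstant.mem_attain_iff {α t : ℝ} (hα : Irrational α)
    (ht : HasLagrangeConstant α t) (x : ℤ × ℕ+) :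
    ENNReal.ofReal |α - (x.1 : ℝ) / (x.2 : ℝ)| ≤
      1 / (lagrangeConstant α * ((x.2 : ℕ) : ENNReal) ^ 2) ↔ approxVal α x ≤ t⁻¹ := by
  obtain ⟨h1, -⟩ := HasLagrangeConstant.liminf_eq hα ht
  have hq : (0 : ℝ) < ((x.2 : ℕ) : ℝ) := by exact_mod_cast x.2.pos
  have e1 : lagrangeConstant α = ENNReal.ofReal t := by
    rw [← ht.2, ENNReal.ofReal_toReal ht.1]
  have e2 : (((x.2 : ℕ) : ENNReal) ^ 2) = ENNReal.ofReal (((x.2 : ℕ) : ℝ) ^ 2) := by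
    rw [ENNReal.ofReal_pow hq.le, ENNReal.ofReal_natCast]
  rw [e1, e2, ← ENNReal.ofReal_mul (by linarith), one_div,
    ← ENNReal.ofReal_inv_of_pos (by positivity), ENNReal.ofReal_le_ofReal_iff (by positivity),
    approxVal]
  have e3 : (((x.2 : ℕ) : ℝ)) * ((((x.2 : ℕ) : ℝ)) * α - x.1) =
      (α - x.1 / ((x.2 : ℕ) : ℝ)) * (((x.2 : ℕ) : ℝ)) ^ 2 := by
    field_simp
  rw [e3, abs_mul, abs_of_pos (by positivity : (0 : ℝ) < (((x.2 : ℕ) : ℝ)) ^ 2),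
    mul_inv, ← div_eq_mul_inv, le_div_iff₀ (by positivity)]

lemma HasLagrangeConstant.unique {α s t : ℝ} (hs : HasLagrangeConstant α s)
    (ht : HasLagrangeConstant α t) : s = t := hs.2.symm.trans ht.2

/-! ### Möbius maps and linear forms -/

/-- The modular group. -/
abbrev SLZ := Matrix.SpecialLinearGroup (Fin 2) ℤ

/-- The denominator `c x + d` of the Möbius transformation given by `M`. -/
def den (M : SLZ) (x : ℝ) : ℝ := (M 1 0 : ℝ) * x + (M 1 1 : ℝ)

lemma den_eq (M : SLZ) (x : ℝ) : den M x = (M 1 0 : ℝ) * x + (M 1 1 : ℝ) := rfl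

/-- The Möbius transformation given by `M` maps the finite point `x` to the finite point `y`. -/
def Maps (M : SLZ) (x y : ℝ) : Prop :=
  den M x ≠ 0 ∧ (M 0 0 : ℝ) * x + (M 0 1 : ℝ) = y * den M x

/-- The linear form `p - x q` at the integer vector `(p, q)`. -/
def ell (x : ℝ) (v : Fin 2 → ℤ) : ℝ := (v 0 : ℝ) - x * (v 1 : ℝ)

/-- The action of the modular group on integer vectors. -/
def act (M : SLZ) (v : Fin 2 → ℤ) : Fin 2 → ℤ :=
  ![M 0 0 * v 0 + M 0 1 * v 1, M 1 0 * v 0 + M 1 1 * v 1]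

lemma det_eq (M : SLZ) : M 0 0 * M 1 1 - M 0 1 * M 1 0 = 1 := by
  have := M.det_coe
  rwa [Matrix.det_fin_two] at this

lemma det_eq_real (M : SLZ) :
    (M 0 0 : ℝ) * (M 1 1 : ℝ) - (M 0 1 : ℝ) * (M 1 0 : ℝ) = 1 := by
  exact_mod_cast det_eq M

lemma mul_entry (M N : SLZ) (i j : Fin 2) :
    (M * N) i j = M i 0 * N 0 j + M i 1 * N 1 j := by
  simp [Matrix.mul_apply, Fin.sum_univ_two]

lemma inv_entries (M : SLZ) :
    M⁻¹ 0 0 = M 1 1 ∧ M⁻¹ 0 1 = - M 0 1 ∧ M⁻¹ 1 0 = - M 1 0 ∧ M⁻¹ 1 1 = M 0 0 := by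
  simp [Matrix.SpecialLinearGroup.SL2_inv_expl]

lemma exists_maps {M : SLZ} {x : ℝ} (h : den M x ≠ 0) : ∃ y, Maps M x y :=
  ⟨((M 0 0 : ℝ) * x + (M 0 1 : ℝ)) / den M x, h, by field_simp⟩

lemma Maps.eq_div {M : SLZ} {x y : ℝ} (h : Maps M x y) :
    y = ((M 0 0 : ℝ) * x + (M 0 1 : ℝ)) / den M x := by
  rw [h.2, mul_div_cancel_right₀ _ h.1]

lemma Maps.mul_den {M N : SLZ} {x y : ℝ} (h : Maps M x y) :
    den (N * M) x = den N y * den M x := by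
  have := h.2
  simp only [den, mul_entry, Int.cast_add, Int.cast_mul] at this ⊢
  linear_combination (N 1 0 : ℝ) * this

lemma Maps.mul {M N : SLZ} {x y z : ℝ} (h : Maps M x y) (h' : Maps N y z) :
    Maps (N * M) x z := by
  refine ⟨by rw [h.mul_den]; exact mul_ne_zero h'.1 h.1, ?_⟩
  rw [h.mul_den]
  have h1 := h.2
  have h2 := h'.2
  simp only [mul_entry, Int.cast_add, Int.cast_mul]
  linear_combination (N 0 0 : ℝ) * h1 + den M x * h2 - (N 0 1 : ℝ) * (den_eq M x)

lemma Maps.inv_den {M : SLZ} {x y : ℝ} (h : Maps M x y) : den M⁻¹ y = (den M x)⁻¹ := by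
  refine eq_inv_of_mul_eq_one_left ?_
  obtain ⟨-, -, h10, h11⟩ := inv_entries M
  have h1 := h.2
  have h2 := det_eq_real M
  simp only [den, h10, h11, Int.cast_neg] at h1 ⊢
  linear_combination (M 1 0 : ℝ) * h1 + h2

lemma Maps.inv {M : SLZ} {x y : ℝ} (h : Maps M x y) : Maps M⁻¹ y x := by
  refine ⟨by rw [h.inv_den]; exact inv_ne_zero h.1, ?_⟩
  rw [h.inv_den, eq_mul_inv_iff_mul_eq₀ h.1]
  obtain ⟨h00, h01, -, -⟩ := inv_entries M
  have h1 := h.2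
  have h2 := det_eq_real M
  simp only [den, h00, h01, Int.cast_neg] at h1 ⊢
  linear_combination (-(M 1 1 : ℝ)) * h1 + x * h2

lemma Maps.of_inv {M : SLZ} {x y : ℝ} (h : Maps M⁻¹ y x) : Maps M x y := by
  simpa using h.inv

/-- The basic distortion identity: determinant one makes a Möbius map scale differences by the
inverse product of denominators. -/
lemma Maps.sub {M : SLZ} {x y x' y' : ℝ} (hx : Maps M x x') (hy : Maps M y y') :
    (x' - y') * (den M x * den M y) = x - y := by
  have h1 := hx.2
  have h2 := hy.2
  have h3 := det_eq_real M
  have : (x' - y') * (den M x * den M y) =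
    (x' * den M x) * den M y - (y' * den M y) * den M x := by ring
  rw [this, ← h1, ← h2]
  simp only [den]
  linear_combination (x - y) * h3

lemma den_sub (M : SLZ) (x y : ℝ) : den M x - den M y = (M 1 0 : ℝ) * (x - y) := by
  simp only [den]; ring

/-- Linear forms carry the same factor, so together with `Maps.sub` the ratio of `ell x v * ell y v`
to `x - y` is invariant under the joint action. -/
lemma Maps.ell_act {M : SLZ} {x x' : ℝ} (h : Maps M x x') (v : Fin 2 → ℤ) :
    ell x' (act M v) * den M x = ell x v := by
  have h1 := h.2
  have h2 := det_eq_real M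
  have h4 : x' * ((M 1 0 : ℝ) * x + M 1 1) = (M 0 0 : ℝ) * x + M 0 1 := by
    rw [h1]; rfl
  simp only [ell, act, den, Matrix.cons_val_zero, Matrix.cons_val_one, Int.cast_add, Int.cast_mul]
  linear_combination (-((M 1 0 : ℝ) * v 0 + M 1 1 * v 1)) * h4 + (v 0 - x * v 1 : ℝ) * h2

lemma act_mul (M N : SLZ) (v : Fin 2 → ℤ) : act (M * N) v = act M (act N v) := by
  funext i
  fin_cases i <;> simp [act, mul_entry] <;> ring

lemma act_one (v : Fin 2 → ℤ) : act 1 v = v := by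
  funext i
  fin_cases i <;> simp [act]

lemma act_inv_act (M : SLZ) (v : Fin 2 → ℤ) : act M⁻¹ (act M v) = v := by
  rw [← act_mul, inv_mul_cancel, act_one]

lemma act_zero (M : SLZ) : act M 0 = 0 := by
  funext i
  fin_cases i <;> simp [act]

lemma act_ne_zero (M : SLZ) {v : Fin 2 → ℤ} (hv : v ≠ 0) : act M v ≠ 0 := by
  intro h
  apply hv
  rw [← act_inv_act M v, h, act_zero]

lemma ell_sub (x y : ℝ) (v : Fin 2 → ℤ) : ell y v - ell x v = (x - y) * v 1 := by
  simp only [ell]; ring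

/-! ### Hyperbolic elements and their fixed points -/

/-- `M` is a hyperbolic element with fixed points `X` (repelling) and `Y` (attracting). -/
structure Hyp (M : SLZ) (X Y : ℝ) : Prop where
  mapsX : Maps M X X
  mapsY : Maps M Y Y
  one_lt : 1 < den M Y
  ne : X ≠ Y

namespace Hyp

variable {M : SLZ} {X Y : ℝ}

lemma denX (h : Hyp M X Y) : den M X = (den M Y)⁻¹ := by
  have h1 := h.mapsX.sub h.mapsY
  have h2 : X - Y ≠ 0 := sub_ne_zero.2 h.ne
  refine eq_inv_of_mul_eq_one_left ?_
  exact mul_left_cancel₀ h2 (by linarith)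

lemma pos (h : Hyp M X Y) : 0 < den M Y := zero_lt_one.trans h.one_lt

lemma ellX_act (h : Hyp M X Y) (v : Fin 2 → ℤ) : ell X (act M v) = den M Y * ell X v := by
  have h1 := h.mapsX.ell_act v
  rw [h.denX] at h1
  have := h.pos.ne'
  field_simp at h1
  linarith

lemma ellY_act (h : Hyp M X Y) (v : Fin 2 → ℤ) : ell Y (act M v) = (den M Y)⁻¹ * ell Y v := by
  have h1 := h.mapsY.ell_act v
  have := h.pos.ne'
  rw [← h1]
  field_simp

lemma ellX_act_inv (h : Hyp M X Y) (v : Fin 2 → ℤ) :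
    ell X (act M⁻¹ v) = (den M Y)⁻¹ * ell X v := by
  have := h.ellX_act (act M⁻¹ v)
  rw [← act_mul, mul_inv_cancel, act_one] at this
  rw [this, inv_mul_cancel_left₀ h.pos.ne']

lemma ellY_act_inv (h : Hyp M X Y) (v : Fin 2 → ℤ) :
    ell Y (act M⁻¹ v) = den M Y * ell Y v := by
  have := h.ellY_act (act M⁻¹ v)
  rw [← act_mul, mul_inv_cancel, act_one] at this
  rw [this, mul_inv_cancel_left₀ h.pos.ne']

lemma ell_zpow (h : Hyp M X Y) (v : Fin 2 → ℤ) (n : ℤ) :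
    ell X (act (M ^ n) v) = den M Y ^ n * ell X v ∧
      ell Y (act (M ^ n) v) = den M Y ^ (-n) * ell Y v := by
  have h0 := h.pos.ne'
  induction n with
  | zero => simp [act_one]
  | succ n ih =>
    rw [add_comm, zpow_add, zpow_one, act_mul, h.ellX_act, h.ellY_act, ih.1, ih.2]
    rw [neg_add, zpow_add₀ h0, zpow_add₀ h0, zpow_one, zpow_neg_one]
    constructor <;> ring
  | pred n ih =>
    rw [sub_eq_add_neg, add_comm, zpow_add, zpow_neg_one, act_mul, h.ellX_act_inv,
      h.ellY_act_inv, ih.1, ih.2]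
    rw [neg_add, zpow_add₀ h0, zpow_add₀ h0, zpow_neg_one, neg_neg, neg_neg, zpow_one]
    constructor <;> ring

/-- Infinite descent: on a vector killed by `ell X`, the form `ell Y` is `X - Y` times the second
entry. Since `M` preserves the kernel and shrinks `ell Y`, it strictly shrinks that integer entry.
-/
lemma ellX_ne_zero (h : Hyp M X Y) {v : Fin 2 → ℤ} (hv : v ≠ 0) : ell X v ≠ 0 := by
  intro h0
  have key : ∀ n : ℕ, ∀ v : Fin 2 → ℤ, v ≠ 0 → ell X v = 0 → (v 1).natAbs ≠ n := by
    intro n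
    induction n using Nat.strong_induction_on with
    | _ n ih =>
      intro v hv h0 hn
      have hv1 : v 1 ≠ 0 := by
        intro h1
        apply hv
        have : (v 0 : ℝ) = 0 := by simpa [ell, h1] using h0
        funext i
        fin_cases i
        · exact_mod_cast this
        · exact h1
      have h3 : ell X (act M v) = 0 := by rw [h.ellX_act, h0, mul_zero]
      refine ih _ ?_ (act M v) (act_ne_zero M hv) h3 rfl
      have e1 := ell_sub X Y v
      have e2 := ell_sub X Y (act M v)
      rw [h.ellY_act, h3] at e2
      rw [h0] at e1
      have hne : X - Y ≠ 0 := sub_ne_zero.2 h.ne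
      have e3 : ((act M v 1 : ℤ) : ℝ) = (den M Y)⁻¹ * v 1 := by
        apply mul_left_cancel₀ hne
        linear_combination -e2 + (den M Y)⁻¹ * e1
      have e4 : |((act M v 1 : ℤ) : ℝ)| < |(v 1 : ℝ)| := by
        rw [e3, abs_mul, abs_of_pos (inv_pos.2 h.pos)]
        have : 0 < |(v 1 : ℝ)| := abs_pos.2 (by exact_mod_cast hv1)
        have h5 := inv_lt_one_of_one_lt₀ h.one_lt
        nlinarith
      have e5 : |act M v 1| < |v 1| := by exact_mod_cast e4
      rw [← hn]
      exact Int.ofNat_lt.1 (by simpa only [Int.natCast_natAbs] using e5)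
  exact key _ v hv h0 rfl

end Hyp

lemma irrational_of_ell_ne_zero {X : ℝ} (h : ∀ v : Fin 2 → ℤ, v ≠ 0 → ell X v ≠ 0) :
    Irrational X := by
  rintro ⟨q, rfl⟩
  have hd : (q.den : ℝ) ≠ 0 := by exact_mod_cast q.den_ne_zero
  refine h ![q.num, q.den] ?_ ?_
  · intro h0
    have := congrFun h0 1
    simp at this
  · simp only [ell, Matrix.cons_val_zero, Matrix.cons_val_one, Int.cast_natCast]
    have : (q : ℝ) * q.den = q.num := by exact_mod_cast Rat.mul_den_eq_num q
    linarith

lemma ell_ne_zero_of_irrational {X : ℝ} (h : Irrational X) {v : Fin 2 → ℤ} (hv : v ≠ 0) :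
    ell X v ≠ 0 := by
  intro h0
  have hv1 : v 1 ≠ 0 := by
    intro h1
    apply hv
    have : (v 0 : ℝ) = 0 := by simpa [ell, h1] using h0
    funext i
    fin_cases i
    · exact_mod_cast this
    · exact h1
  refine h ⟨(v 0 : ℚ) / v 1, ?_⟩
  have : (v 1 : ℝ) ≠ 0 := by exact_mod_cast hv1
  push_cast
  rw [div_eq_iff this]
  simp only [ell] at h0
  linarith

lemma Hyp.irrational {M : SLZ} {X Y : ℝ} (h : Hyp M X Y) : Irrational X :=
  irrational_of_ell_ne_zero fun _ hv => h.ellX_ne_zero hv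

lemma Hyp.quadratic {M : SLZ} {X Y : ℝ} (h : Hyp M X Y) : IsQuadraticIrrationality X := by
  refine ⟨h.irrational, M 1 0, M 1 1 - M 0 0, - M 0 1, ?_, ?_⟩
  · intro h0
    have h1 := det_eq M
    have h2 := h.one_lt
    have h3 := h.denX
    simp only [den, h0, Int.cast_zero, zero_mul, zero_add] at h2 h3
    have h4 := inv_lt_one_of_one_lt₀ h2
    linarith
  · have := h.mapsX.2
    simp only [den] at this
    push_cast
    linear_combination -this

/-! ### The Lagrange constant of a fixed point -/

lemma finite_of_bounded {S : Set (ℤ × ℕ+)} {α K Q : ℝ}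
    (h : ∀ x ∈ S, (x.2 : ℝ) ≤ Q ∧ |(x.2 : ℝ) * α - x.1| ≤ K) : S.Finite := by
  obtain ⟨n, hn⟩ := exists_nat_gt Q
  obtain ⟨N, hN⟩ := exists_nat_gt (K + |Q| * |α|)
  have hf : ((Set.Icc (-(N : ℤ)) N) ×ˢ (Set.Iic n.succPNat)).Finite :=
    (Set.finite_Icc _ _).prod (Set.finite_Iic _)
  refine hf.subset fun x hx => ?_
  obtain ⟨h1, h2⟩ := h x hx
  have hq : (0 : ℝ) < ((x.2 : ℕ) : ℝ) := by exact_mod_cast x.2.pos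
  have h4 : |((x.2 : ℕ) : ℝ) * α| ≤ |Q| * |α| := by
    rw [abs_mul, abs_of_pos hq]
    exact mul_le_mul_of_nonneg_right (h1.trans (le_abs_self Q)) (abs_nonneg _)
  have h5 : |(x.1 : ℝ)| < N := by
    have e : (x.1 : ℝ) = (x.2 : ℝ) * α - ((x.2 : ℝ) * α - x.1) := by ring
    rw [e]
    have := abs_sub ((x.2 : ℝ) * α) ((x.2 : ℝ) * α - x.1)
    linarith
  have h6 : |x.1| < N := by exact_mod_cast h5
  refine Set.mem_prod.2 ⟨⟨?_, ?_⟩, ?_⟩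
  · linarith [(abs_lt.1 h6).1]
  · linarith [(abs_lt.1 h6).2]
  · have h7 : ((x.2 : ℕ) : ℝ) < n := by linarith
    have h8 : (x.2 : ℕ) < n := by exact_mod_cast h7
    show x.2 ≤ _
    rw [← PNat.coe_le_coe]
    simp only [Nat.succPNat_coe]
    omega

/-- With `e = |qX - p|`, the form at `(p, q)` is at most `e² + qe|X - Y|`. If `qe < c' < c`, this
forces `e² ≥ (c - c')|X - Y|`, and `qe < c'` then bounds `q`. -/
lemma finite_approxVal_lt {X Y c : ℝ} (hXY : X ≠ Y)
    (h : ∀ v : Fin 2 → ℤ, v ≠ 0 → c * |X - Y| ≤ |ell X v| * |ell Y v|) :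
    ∀ c' < c, {x | approxVal X x < c'}.Finite := by
  intro c' hc'
  have hD : 0 < |X - Y| := abs_pos.2 (sub_ne_zero.2 hXY)
  have hd : 0 < (c - c') * |X - Y| := mul_pos (by linarith) hD
  refine finite_of_bounded (α := X) (K := c') (Q := max 1 (c' ^ 2 / ((c - c') * |X - Y|))) ?_
  intro x hx
  have hx' : approxVal X x < c' := hx
  have hq : (1 : ℝ) ≤ ((x.2 : ℕ) : ℝ) := by exact_mod_cast x.2.pos
  set q : ℝ := ((x.2 : ℕ) : ℝ) with hqdef
  have hv := h ![x.1, (x.2 : ℕ)] (by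
    intro h0
    have := congrFun h0 1
    simp at this)
  have e1 : |ell X ![x.1, (x.2 : ℕ)]| = |q * X - x.1| := by
    rw [← abs_neg]
    congr 1
    simp [ell]
    ring
  rw [e1] at hv
  set e : ℝ := |q * X - x.1| with hedef
  have he0 : 0 ≤ e := abs_nonneg _
  have hval : q * e < c' := by
    rw [approxVal, abs_mul, abs_of_pos (by linarith)] at hx'
    exact hx'
  have e2 : |ell Y ![x.1, (x.2 : ℕ)]| ≤ e + q * |X - Y| := by
    have : ell Y ![x.1, (x.2 : ℕ)] = -(q * X - x.1) + (X - Y) * q := by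
      simp [ell]
      ring
    rw [this]
    refine (abs_add_le _ _).trans ?_
    rw [abs_neg, abs_mul (X - Y), abs_of_pos (by linarith : 0 < q), mul_comm q |X - Y|]
  have hec : e ≤ c' := by nlinarith
  refine ⟨?_, hec⟩
  by_contra hcon
  push Not at hcon
  have hq1 : 1 < q := (le_max_left _ _).trans_lt hcon
  have hq2 : c' ^ 2 / ((c - c') * |X - Y|) < q := (le_max_right _ _).trans_lt hcon
  rw [div_lt_iff₀ hd] at hq2
  have h1 : c * |X - Y| ≤ e * (e + q * |X - Y|) :=
    hv.trans (mul_le_mul_of_nonneg_left e2 he0)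
  have h2 : q * e * |X - Y| ≤ c' * |X - Y| := by gcongr
  have h3 : (c - c') * |X - Y| ≤ e * e := by nlinarith
  have hc'0 : 0 ≤ c' := he0.trans hec
  have h4 : (q * e) * (q * e) ≤ c' * c' := by gcongr
  nlinarith

lemma infinite_of_unbounded {S : Set (ℤ × ℕ+)} (h : ∀ Q : ℝ, ∃ x ∈ S, Q ≤ (x.2 : ℝ)) :
    S.Infinite := by
  refine Set.Infinite.of_image (fun x : ℤ × ℕ+ => x.2) ?_
  refine Set.infinite_of_forall_exists_gt fun n => ?_
  obtain ⟨x, hx, hq⟩ := h ((n : ℕ) + 1)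
  refine ⟨x.2, ⟨x, hx, rfl⟩, ?_⟩
  have : ((n : ℕ) : ℝ) < ((x.2 : ℕ) : ℝ) := by linarith
  exact_mod_cast this

/-- Every integer vector with nonzero second entry is, up to sign, a pair `(p, q)` with `q` a
positive integer. -/
lemma exists_pair (X : ℝ) {v : Fin 2 → ℤ} (hv : v 1 ≠ 0) :
    ∃ x : ℤ × ℕ+, (x.2 : ℝ) = |(v 1 : ℝ)| ∧ approxVal X x = |(v 1 : ℝ)| * |ell X v| := by
  refine ⟨((v 1).sign * v 0, ⟨(v 1).natAbs, Int.natAbs_pos.2 hv⟩), ?_, ?_⟩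
  · simp [Nat.cast_natAbs]
  · simp only [approxVal, PNat.mk_coe, Nat.cast_natAbs, Int.cast_abs, ell, abs_mul, abs_abs]
    congr 1
    rcases lt_or_gt_of_ne hv with h | h
    · have h' : (v 1 : ℝ) < 0 := by exact_mod_cast h
      rw [Int.sign_eq_neg_one_of_neg h, abs_of_neg h']
      push_cast
      congr 1
      ring
    · have h' : (0 : ℝ) < v 1 := by exact_mod_cast h
      rw [Int.sign_eq_one_of_pos h, abs_of_pos h', ← abs_neg]
      push_cast
      congr 1
      ring

/-- The values of the approximation function along the orbit of `v` under powers of `M⁻¹`. -/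
lemma Hyp.exists_orbit_pair {M : SLZ} {X Y : ℝ} (h : Hyp M X Y) {v : Fin 2 → ℤ} (hY : ell Y v ≠ 0)
    (Q : ℝ) {η : ℝ} (hη : 0 < η) :
    ∃ (x : ℤ × ℕ+) (e : ℝ), Q ≤ (x.2 : ℝ) ∧ 0 ≤ e ∧ e ≤ η ∧
      approxVal X x = |ell X v * ell Y v - e| / |X - Y| := by
  have hD : 0 < |X - Y| := abs_pos.2 (sub_ne_zero.2 h.ne)
  have hW := h.one_lt
  have hW0 := h.pos
  have hYp : 0 < |ell Y v| := abs_pos.2 hY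
  have t1 : Tendsto (fun n : ℕ => (ell X v) ^ 2 * ((den M Y)⁻¹ ^ 2) ^ n) atTop (nhds 0) := by
    have h1 : (den M Y)⁻¹ < 1 := inv_lt_one_of_one_lt₀ hW
    have h2 : 0 < (den M Y)⁻¹ := inv_pos.2 hW0
    have := (tendsto_pow_atTop_nhds_zero_of_lt_one (r := (den M Y)⁻¹ ^ 2) (by positivity)
      (by nlinarith)).const_mul ((ell X v) ^ 2)
    simpa using this
  have t2 : Tendsto (fun n : ℕ => |ell Y v| * (den M Y) ^ n) atTop atTop :=
    (tendsto_pow_atTop_atTop_of_one_lt hW).const_mul_atTop hYp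
  obtain ⟨n, hn1, hn2⟩ := ((t1.eventually (gt_mem_nhds hη)).and
    (t2.eventually_ge_atTop (|X - Y| * max Q 1 + |ell X v|))).exists
  have hz := h.ell_zpow v (-(n : ℤ))
  set w := act (M ^ (-(n : ℤ))) v with hw
  rw [neg_neg, zpow_natCast, zpow_neg, zpow_natCast] at hz
  obtain ⟨hz1, hz2⟩ := hz
  have hWn : 0 < den M Y ^ n := pow_pos hW0 n
  have hWn1 : 1 ≤ den M Y ^ n := one_le_pow₀ hW.le
  have hsub := ell_sub X Y w
  have hX' : |ell X w| ≤ |ell X v| := by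
    rw [hz1, abs_mul, abs_of_pos (inv_pos.2 hWn)]
    exact mul_le_of_le_one_left (abs_nonneg _) (inv_le_one_of_one_le₀ hWn1)
  have hq : max Q 1 ≤ |(w 1 : ℝ)| := by
    have e1 : |X - Y| * |(w 1 : ℝ)| = |ell Y w - ell X w| := by rw [hsub, abs_mul]
    have e2 : |ell Y w| = |ell Y v| * den M Y ^ n := by
      rw [hz2, abs_mul, abs_of_pos hWn, mul_comm]
    have e3 := abs_sub_abs_le_abs_sub (ell Y w) (ell X w)
    have e4 : |X - Y| * max Q 1 ≤ |X - Y| * |(w 1 : ℝ)| := by linarith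
    exact le_of_mul_le_mul_left e4 hD
  have hw1 : w 1 ≠ 0 := by
    intro h0
    rw [h0] at hq
    have := (le_max_right Q 1).trans hq
    norm_num at this
  obtain ⟨x, hx1, hx2⟩ := exists_pair X hw1
  -- Since `ell Y w - ell X w` is `X - Y` times the denominator, the approximation value differs
  -- from the invariant product by exactly this square.
  refine ⟨x, (ell X w) ^ 2, ?_, by positivity, ?_, ?_⟩
  · rw [hx1]; exact (le_max_left _ _).trans hq
  · rw [hz1]
    have : ((den M Y ^ n)⁻¹ * ell X v) ^ 2 = ell X v ^ 2 * ((den M Y)⁻¹ ^ 2) ^ n := by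
      rw [mul_pow, ← inv_pow, ← pow_mul, ← pow_mul, mul_comm n 2, mul_comm]
    rw [this]
    exact hn1.le
  · have e1 : ell X v * ell Y v = ell X w * ell Y w := by
      rw [hz1, hz2]
      field_simp
    have e2 : ell X w * ell Y w - ell X w ^ 2 = ell X w * ((X - Y) * w 1) := by
      rw [← hsub]; ring
    rw [hx2, e1, e2, abs_mul, abs_mul]
    field_simp

lemma Hyp.infinite_approxVal_le {M : SLZ} {X Y : ℝ} (h : Hyp M X Y) {v : Fin 2 → ℤ}
    (hY : ell Y v ≠ 0) {c : ℝ} (hc : |ell X v * ell Y v| / |X - Y| < c) :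
    {x | approxVal X x ≤ c}.Infinite := by
  have hD : 0 < |X - Y| := abs_pos.2 (sub_ne_zero.2 h.ne)
  rw [div_lt_iff₀ hD] at hc
  refine infinite_of_unbounded fun Q => ?_
  obtain ⟨x, e, hxQ, he0, heη, hx⟩ := h.exists_orbit_pair hY Q (sub_pos.2 hc)
  refine ⟨x, ?_, hxQ⟩
  show approxVal X x ≤ c
  rw [hx, div_le_iff₀ hD]
  have := abs_sub (ell X v * ell Y v) e
  rw [abs_of_nonneg he0] at this
  linarith

/-- For a positive product the correction `e` lowers the value, so the bound holds without any loss.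
This is the source of attainability. -/
lemma Hyp.infinite_approxVal_le_of_pos {M : SLZ} {X Y : ℝ} (h : Hyp M X Y) {v : Fin 2 → ℤ}
    (hv : 0 < ell X v * ell Y v) :
    {x | approxVal X x ≤ ell X v * ell Y v / |X - Y|}.Infinite := by
  have hD : 0 < |X - Y| := abs_pos.2 (sub_ne_zero.2 h.ne)
  have hY : ell Y v ≠ 0 := fun h0 => by simp [h0] at hv
  refine infinite_of_unbounded fun Q => ?_
  obtain ⟨x, e, hxQ, he0, heη, hx⟩ := h.exists_orbit_pair hY Q hv
  refine ⟨x, ?_, hxQ⟩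
  show approxVal X x ≤ _
  rw [hx, abs_of_nonneg (by linarith)]
  gcongr
  linarith

/-- If the indefinite form with roots `X` and `Y` is bounded below by `c |X - Y|`, then the Lagrange
constant of `X` is at most `c⁻¹`, and it is at least the value given by any nonzero vector. -/
lemma Hyp.exists_constant_between {M : SLZ} {X Y c : ℝ} (h : Hyp M X Y) (hc : 0 < c)
    (hlow : ∀ v : Fin 2 → ℤ, v ≠ 0 → c * |X - Y| ≤ |ell X v| * |ell Y v|)
    {v : Fin 2 → ℤ} (hv : v ≠ 0) :
    ∃ t, HasLagrangeConstant X t ∧ t ≤ c⁻¹ ∧ |X - Y| / |ell X v * ell Y v| ≤ t := by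
  obtain ⟨t, ht, htc⟩ := exists_hasLagrangeConstant hc (finite_approxVal_lt h.ne hlow)
  refine ⟨t, ht, htc, ?_⟩
  have hD : 0 < |X - Y| := abs_pos.2 (sub_ne_zero.2 h.ne)
  have h1 := (mul_pos hc hD).trans_le (hlow v hv)
  rw [← abs_mul] at h1
  have hY : ell Y v ≠ 0 := fun h0 => by simp [h0] at h1
  have := HasLagrangeConstant.inv_le h.irrational ht (c := |ell X v * ell Y v| / |X - Y|)
    (by positivity) fun c' hc' => h.infinite_approxVal_le hY hc'
  rwa [inv_div] at this

/-! ### Time reversal -/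

/-- Time reversal: the conjugate of `M⁻¹` by the reflection `x ↦ -x`. -/
def flip (M : SLZ) : SLZ :=
  ⟨!![M 1 1, M 0 1; M 1 0, M 0 0], by
    rw [Matrix.det_fin_two_of]
    linarith [det_eq M]⟩

lemma flip_entries (M : SLZ) :
    flip M 0 0 = M 1 1 ∧ flip M 0 1 = M 0 1 ∧ flip M 1 0 = M 1 0 ∧ flip M 1 1 = M 0 0 := by
  simp [flip]

lemma flip_flip (M : SLZ) : flip (flip M) = M := by
  ext i j
  fin_cases i <;> fin_cases j <;> simp [flip]

lemma Maps.flip_den {M : SLZ} {x x' : ℝ} (h : Maps M x x') :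
    den (flip M) (-x') = (den M x)⁻¹ := by
  rw [← h.inv_den]
  simp [den, flip_entries, inv_entries]

lemma Maps.flip {M : SLZ} {x x' : ℝ} (h : Maps M x x') : Maps (flip M) (-x') (-x) := by
  have h1 := h.inv.2
  refine ⟨by rw [h.flip_den]; exact inv_ne_zero h.1, ?_⟩
  rw [h.flip_den]
  rw [h.inv_den] at h1
  simp only [flip_entries, inv_entries, Int.cast_neg] at h1 ⊢
  linear_combination -h1

lemma Hyp.inv {M : SLZ} {X Y : ℝ} (h : Hyp M X Y) : Hyp M⁻¹ Y X := by
  refine ⟨h.mapsY.inv, h.mapsX.inv, ?_, h.ne.symm⟩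
  rw [h.mapsX.inv_den, h.denX, inv_inv]
  exact h.one_lt

lemma Hyp.ellY_ne_zero {M : SLZ} {X Y : ℝ} (h : Hyp M X Y) {v : Fin 2 → ℤ} (hv : v ≠ 0) :
    ell Y v ≠ 0 := h.inv.ellX_ne_zero hv

lemma Hyp.flip {M : SLZ} {X Y : ℝ} (h : Hyp M X Y) : Hyp (flip M) (-Y) (-X) := by
  refine ⟨h.mapsY.flip, h.mapsX.flip, ?_, fun h' => h.ne (neg_injective h').symm⟩
  rw [h.mapsX.flip_den, h.denX, inv_inv]
  exact h.one_lt

/-- The normalized indefinite form with roots `X > Y` is bounded below by `c⁻¹`. -/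
def Good (c X Y : ℝ) : Prop :=
  ∀ v : Fin 2 → ℤ, v ≠ 0 → X - Y ≤ c * (|ell X v| * |ell Y v|)

lemma Good.flip {c X Y : ℝ} (h : Good c X Y) : Good c (-Y) (-X) := by
  intro v hv
  have h1 := h ![v 0, - v 1] (by
    intro h0
    apply hv
    funext i
    have e0 := congrFun h0 0
    have e1 := congrFun h0 1
    fin_cases i
    · simpa using e0
    · simpa using e1)
  have e : ∀ x : ℝ, ell x ![v 0, - v 1] = ell (-x) v := fun x => by simp [ell]
  rw [e, e] at h1
  linarith [mul_comm |ell (-X) v| |ell (-Y) v|]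

/-- `M` maps the pair `(x, y)` to the pair `(x', y')`, and both pairs are within `δ` of
`(xb, yb)`. -/
structure Seg (xb yb δ : ℝ) (M : SLZ) (x y x' y' : ℝ) : Prop where
  base : 1 ≤ xb - yb
  mapsx : Maps M x x'
  mapsy : Maps M y y'
  hx : |x - xb| ≤ δ
  hy : |y - yb| ≤ δ
  hx' : |x' - xb| ≤ δ
  hy' : |y' - yb| ≤ δ

namespace Seg

variable {xb yb δ : ℝ} {M : SLZ} {x y x' y' : ℝ}

lemma den_mul_bounds (h : Seg xb yb δ M x y x' y') (hδ : δ ≤ 1 / 100) :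
    9 / 10 ≤ den M x * den M y ∧ den M x * den M y ≤ 11 / 10 := by
  have h1 := h.mapsx.sub h.mapsy
  have hb := h.base
  have a1 := abs_le.1 h.hx
  have a2 := abs_le.1 h.hy
  have a3 := abs_le.1 h.hx'
  have a4 := abs_le.1 h.hy'
  have h2 : 0 < x' - y' := by linarith [a3.1, a4.2]
  constructor
  · by_contra hc
    push Not at hc
    nlinarith [mul_lt_mul_of_pos_left hc h2]
  · by_contra hc
    push Not at hc
    nlinarith [mul_lt_mul_of_pos_left hc h2]

lemma denx_pos (h : Seg xb yb δ M x y x' y') (hδ : δ ≤ 1 / 100) (hw : 0 < den M y) :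
    0 < den M x := by
  have := (h.den_mul_bounds hδ).1
  by_contra hc
  push Not at hc
  nlinarith

lemma flip (h : Seg xb yb δ M x y x' y') :
    Seg (-yb) (-xb) δ (flip M) (-y') (-x') (-y) (-x) := by
  refine ⟨by linarith [h.base], h.mapsy.flip, h.mapsx.flip, ?_, ?_, ?_, ?_⟩
  · rw [neg_sub_neg, abs_sub_comm]; exact h.hy'
  · rw [neg_sub_neg, abs_sub_comm]; exact h.hx'
  · rw [neg_sub_neg, abs_sub_comm]; exact h.hy
  · rw [neg_sub_neg, abs_sub_comm]; exact h.hx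

lemma flip_den_ge (h : Seg xb yb δ M x y x' y') (hδ : δ ≤ 1 / 100) (hw : 0 < den M y) :
    10 / 11 * den M y ≤ den (LagrangeGap.flip M) (-x') := by
  rw [h.mapsx.flip_den]
  have hu := h.denx_pos hδ hw
  rw [le_inv_comm₀ (by positivity) hu, le_inv_comm₀ hu (by positivity), ← one_div,
    le_div_iff₀ hu]
  nlinarith [(h.den_mul_bounds hδ).2]

/-- The denominator is affine, falling from `den M y` at `y` to a small positive value at `x`, at
distance at least 0.98. This bounds its slope and keeps it within a factor `1 ± 1/2` on the stated
neighbourhood. -/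
lemma den_near (h : Seg xb yb δ M x y x' y') (hδ : δ ≤ 1 / 100) (hw : 3 ≤ den M y) {z : ℝ}
    (hz : |z - y| ≤ 2 / 5) : den M y / 2 ≤ den M z ∧ den M z ≤ 3 * den M y / 2 := by
  have hu := h.denx_pos hδ (by linarith)
  have hb := h.base
  have hmul := (h.den_mul_bounds hδ).2
  have a1 := abs_le.1 h.hx
  have a2 := abs_le.1 h.hy
  have e1 := den_sub M x y
  have e2 := den_sub M z y
  have hxy : 98 / 100 ≤ x - y := by linarith [a1.1, a2.2]
  have hlt : den M x < den M y := by nlinarith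
  have hC0 : (M 1 0 : ℝ) < 0 := by
    by_contra hc
    push Not at hc
    nlinarith [mul_nonneg hc (by linarith : (0 : ℝ) ≤ x - y)]
  have hC1 : -(M 1 0 : ℝ) * (98 / 100) ≤ den M y := by nlinarith
  have hz' := abs_le.1 hz
  constructor <;> nlinarith [hz'.1, hz'.2]

lemma exists_maps_near (h : Seg xb yb δ M x y x' y') (hδ : δ ≤ 1 / 100) (hw : 3 ≤ den M y)
    {z : ℝ} (hz : |z - y| ≤ 2 / 5) :
    ∃ z', Maps M z z' ∧ |z' - y'| ≤ 2 * |z - y| / den M y ^ 2 := by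
  obtain ⟨h1, h2⟩ := h.den_near hδ hw hz
  have hw0 : 0 < den M y := by linarith
  have hz0 : 0 < den M z := by linarith
  obtain ⟨z', hz'⟩ := exists_maps hz0.ne'
  refine ⟨z', hz', ?_⟩
  have e := hz'.sub h.mapsy
  rw [← e, abs_mul, abs_of_pos (mul_pos hz0 hw0), le_div_iff₀ (by positivity)]
  have : |z' - y'| * (den M y / 2 * den M y) ≤ |z' - y'| * (den M z * den M y) := by gcongr
  nlinarith

/-- Time reversal of `exists_maps_near`: `M` contracts near `y`, and its inverse contracts near
`x'`. The constant 3 absorbs `2 * (11/10)²`. -/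
lemma exists_maps_near' (h : Seg xb yb δ M x y x' y') (hδ : δ ≤ 1 / 100) (hw : 4 ≤ den M y)
    {z' : ℝ} (hz : |z' - x'| ≤ 2 / 5) :
    ∃ z, Maps M z z' ∧ |z - x| ≤ 3 * |z' - x'| / den M y ^ 2 ∧ 0 < den M z ∧
      den M z ≤ 3 / den M y := by
  have hf := h.flip_den_ge hδ (by linarith)
  have hz2 : |-z' - -x'| ≤ 2 / 5 := by rwa [neg_sub_neg, abs_sub_comm]
  obtain ⟨t, ht1, ht2⟩ := h.flip.exists_maps_near hδ (by linarith) hz2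
  obtain ⟨hd1, hd2⟩ := h.flip.den_near hδ (by linarith) hz2
  have hm : Maps M (-t) z' := by
    have := ht1.flip
    rwa [flip_flip, neg_neg] at this
  have hw0 : 0 < den M y := by linarith
  have hden : den (LagrangeGap.flip M) (-z') = (den M (-t))⁻¹ := hm.flip_den
  rw [hden] at hd1 hd2
  have hpos : 0 < den M (-t) := inv_pos.1 (by linarith)
  refine ⟨-t, hm, ?_, hpos, ?_⟩
  · rw [neg_sub_neg, abs_sub_comm x'] at ht2
    have e : |-t - x| = |t - -x| := by rw [← abs_neg]; congr 1; ring
    rw [e]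
    refine ht2.trans ?_
    have hf0 : 0 < den (LagrangeGap.flip M) (-x') := by linarith
    rw [div_le_div_iff₀ (by positivity) (by positivity)]
    have h1 : (10 / 11 * den M y) ^ 2 ≤ den (LagrangeGap.flip M) (-x') ^ 2 := by gcongr
    nlinarith [abs_nonneg (z' - x'), mul_le_mul_of_nonneg_left h1 (abs_nonneg (z' - x')),
      mul_nonneg (abs_nonneg (z' - x')) (sq_nonneg (den M y))]
  · rw [le_div_iff₀ hw0]
    have : den M y / 3 ≤ (den M (-t))⁻¹ := by linarith
    have h3 := mul_le_mul_of_nonneg_left this hpos.le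
    rw [mul_inv_cancel₀ hpos.ne'] at h3
    linarith

lemma exists_fixed (h : Seg xb yb δ M x y x' y') (hδ : δ ≤ 1 / 100) (hw : 3 ≤ den M y) :
    ∃ Y, Maps M Y Y ∧ |Y - y| ≤ 3 * δ ∧ |Y - y'| ≤ 6 * δ / den M y ^ 2 ∧
      den M y / 2 ≤ den M Y ∧ den M Y ≤ 3 * den M y / 2 := by
  have hw0 : 0 < den M y := by linarith
  have hI : ∀ z ∈ Set.Icc (yb - 1 / 4) (yb + 1 / 4), |z - y| ≤ 2 / 5 := by
    intro z hz
    have a2 := abs_le.1 h.hy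
    rw [abs_le]
    constructor <;> linarith [hz.1, hz.2, a2.1, a2.2]
  have hsq : 9 ≤ den M y ^ 2 := by nlinarith
  -- The contraction sends this interval within `1/10` of `y'`, hence into itself; the intermediate
  -- value theorem gives a fixed point.
  obtain ⟨Y, hYI, hY⟩ := exists_mem_Icc_isFixedPt_of_mapsTo
    (f := fun z => ((M 0 0 : ℝ) * z + (M 0 1 : ℝ)) / den M z)
    (a := yb - 1 / 4) (b := yb + 1 / 4) (by
      have : ∀ z ∈ Set.Icc (yb - 1 / 4) (yb + 1 / 4), den M z ≠ 0 := fun z hz =>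
        (lt_of_lt_of_le (by linarith) (h.den_near hδ hw (hI z hz)).1).ne'
      unfold den at this ⊢
      fun_prop (disch := assumption)) (by linarith) (by
      intro z hz
      obtain ⟨z', h1, h2⟩ := h.exists_maps_near hδ hw (hI z hz)
      show ((M 0 0 : ℝ) * z + (M 0 1 : ℝ)) / den M z ∈ _
      rw [← h1.eq_div]
      have h3 : 2 * |z - y| / den M y ^ 2 ≤ 1 / 10 := by
        rw [div_le_iff₀ (by positivity)]
        linarith [hI z hz]
      have a1 := abs_le.1 (h2.trans h3)
      have a2 := abs_le.1 h.hy'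
      constructor <;> linarith [a1.1, a1.2, a2.1, a2.2])
  have hd := h.den_near hδ hw (hI Y hYI)
  obtain ⟨Y', h1, h2⟩ := h.exists_maps_near hδ hw (hI Y hYI)
  have hYY : Y' = Y := by rw [h1.eq_div]; exact hY
  subst hYY
  rw [le_div_iff₀ (by positivity)] at h2
  have h3 : |Y' - y| ≤ |Y' - y'| + 2 * δ := by
    have e : Y' - y = (Y' - y') + ((y' - yb) + (yb - y)) := by ring
    rw [e]
    refine (abs_add_le _ _).trans (add_le_add le_rfl ?_)
    refine (abs_add_le _ _).trans ?_
    rw [abs_sub_comm yb y]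
    linarith [h.hy, h.hy']
  have hδ0 : 0 ≤ δ := (abs_nonneg _).trans h.hy
  have h4 : |Y' - y| ≤ 3 * δ := by
    nlinarith [abs_nonneg (Y' - y')]
  refine ⟨Y', h1, h4, ?_, hd⟩
  rw [le_div_iff₀ (by positivity)]
  linarith

/-- The attracting fixed point comes from `exists_fixed`, the repelling one from its time reversal.
The bound on `|X - x| * den M Y ^ 2` is the precision needed to compare forms over a whole period.
-/
lemma exists_hyp (h : Seg xb yb δ M x y x' y') (hδ : δ ≤ 1 / 100) (hw : 4 ≤ den M y) :
    ∃ X Y, Hyp M X Y ∧ |X - x| ≤ 8 * δ / den M y ^ 2 ∧ |Y - y'| ≤ 6 * δ / den M y ^ 2 ∧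
      |X - x| ≤ δ ∧ |Y - y| ≤ 3 * δ ∧ |X - x| * den M Y ^ 2 ≤ 18 * δ ∧
      den M y / 2 ≤ den M Y ∧ 9 / 10 ≤ X - Y := by
  have hw0 : 0 < den M y := by linarith
  have hδ0 : 0 ≤ δ := (abs_nonneg _).trans h.hy
  obtain ⟨Y, hY, hYy, hYy', hW1, hW2⟩ := h.exists_fixed hδ (by linarith)
  have hf := h.flip_den_ge hδ hw0
  obtain ⟨X', hX, -, hXx, -, -⟩ := h.flip.exists_fixed hδ (by linarith)
  obtain ⟨X, rfl⟩ : ∃ X, X' = -X := ⟨-X', by ring⟩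
  have hXM : Maps M X X := by
    have := hX.flip
    rwa [flip_flip, neg_neg] at this
  have hf0 : 0 < den (LagrangeGap.flip M) (-x') := by linarith
  have hXx' : |X - x| ≤ 8 * δ / den M y ^ 2 := by
    rw [neg_sub_neg, abs_sub_comm] at hXx
    refine hXx.trans ?_
    rw [div_le_div_iff₀ (by positivity) (by positivity)]
    have h1 : (10 / 11 * den M y) ^ 2 ≤ den (LagrangeGap.flip M) (-x') ^ 2 := by gcongr
    nlinarith [mul_le_mul_of_nonneg_left h1 hδ0, mul_nonneg hδ0 (sq_nonneg (den M y))]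
  have hsq : 16 ≤ den M y ^ 2 := by nlinarith
  have hXx1 : |X - x| ≤ δ := by
    refine hXx'.trans ?_
    rw [div_le_iff₀ (by positivity)]
    nlinarith
  have hXY : 9 / 10 ≤ X - Y := by
    have a1 := abs_le.1 hXx1
    have a2 := abs_le.1 hYy
    have a3 := abs_le.1 h.hx
    have a4 := abs_le.1 h.hy
    linarith [a1.1, a2.2, a3.1, a4.2, h.base]
  have hyp : Hyp M X Y := ⟨hXM, hY, by linarith, by intro h0; rw [h0] at hXY; linarith⟩
  refine ⟨X, Y, hyp, hXx', hYy', hXx1, hYy, ?_, hW1, hXY⟩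
  rw [le_div_iff₀ (by positivity)] at hXx'
  have hW0 := hyp.pos
  have h1 : den M Y ^ 2 ≤ (3 * den M y / 2) ^ 2 := by gcongr
  nlinarith [mul_le_mul_of_nonneg_left h1 (abs_nonneg (X - x))]

end Seg

/-! ### The closing lemma -/

lemma abs_ell_le {X x A : ℝ} {v : Fin 2 → ℤ} (h : |X - x| * |(v 1 : ℝ)| ≤ A * |ell X v|) :
    |ell x v| ≤ (1 + A) * |ell X v| := by
  have e2 : ell x v = ell X v + (X - x) * v 1 := by rw [← ell_sub]; ring
  have e3 : |ell x v| ≤ |ell X v| + |X - x| * |(v 1 : ℝ)| := by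
    rw [e2, ← abs_mul]; exact abs_add_le _ _
  linarith

lemma le_abs_ell {X x A : ℝ} {v : Fin 2 → ℤ} (h : |X - x| * |(v 1 : ℝ)| ≤ A * |ell X v|) :
    (1 - A) * |ell X v| ≤ |ell x v| := by
  have e2 : ell x v = ell X v + (X - x) * v 1 := by rw [← ell_sub]; ring
  have := abs_sub_abs_le_abs_sub (ell X v) (-((X - x) * v 1))
  rw [abs_neg, abs_mul, sub_neg_eq_add, ← e2] at this
  linarith

lemma sub_mul_abs_le {X Y : ℝ} (h : Y ≤ X) (v : Fin 2 → ℤ) :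
    (X - Y) * |(v 1 : ℝ)| ≤ |ell X v| + |ell Y v| := by
  rw [← abs_of_nonneg (sub_nonneg.2 h), ← abs_mul, ← ell_sub X Y v, add_comm]
  exact abs_sub _ _

/-- A lower bound on a fundamental domain for the action of a hyperbolic element extends to all
vectors. -/
lemma Hyp.good_of_fundamental {M : SLZ} {X Y c : ℝ} (hyp : Hyp M X Y)
    (main : ∀ v : Fin 2 → ℤ, v ≠ 0 → |ell X v| ≤ |ell Y v| →
      |ell Y v| ≤ den M Y ^ 2 * |ell X v| → X - Y ≤ c * (|ell X v| * |ell Y v|)) :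
    Good c X Y := by
  intro v hv
  have hX0 : 0 < |ell X v| := abs_pos.2 (hyp.ellX_ne_zero hv)
  have hY0 : 0 < |ell Y v| := abs_pos.2 (hyp.ellY_ne_zero hv)
  -- `M ^ n` divides the ratio `|ell Y v| / |ell X v|` by `W ^ (2n)`, so a suitable power brings it
  -- into `[1, W²)`.
  obtain ⟨n, hn1, hn2⟩ := exists_mem_Ico_zpow (div_pos hY0 hX0)
    (one_lt_pow₀ hyp.one_lt two_ne_zero)
  obtain ⟨z1, z2⟩ := hyp.ell_zpow v n
  have hWpos := hyp.pos
  set W := den M Y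
  have hWn : 0 < W ^ n := zpow_pos hWpos n
  have hvn : act (M ^ n) v ≠ 0 := act_ne_zero _ hv
  have hsq : (W ^ 2) ^ n = W ^ n * W ^ n := by
    rw [sq, mul_zpow]
  rw [le_div_iff₀ hX0, hsq] at hn1
  rw [div_lt_iff₀ hX0, zpow_add_one₀ (by positivity), hsq] at hn2
  have a1 : |ell X (act (M ^ n) v)| = W ^ n * |ell X v| := by
    rw [z1, abs_mul, abs_of_pos hWn]
  have a2 : |ell Y (act (M ^ n) v)| = (W ^ n)⁻¹ * |ell Y v| := by
    rw [z2, abs_mul, zpow_neg, abs_of_pos (inv_pos.2 hWn)]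
  have := main _ hvn ?_ ?_
  · rw [a1, a2] at this
    have e : W ^ n * |ell X v| * ((W ^ n)⁻¹ * |ell Y v|) = |ell X v| * |ell Y v| := by
      field_simp
    rwa [e] at this
  · rw [a1, a2, le_inv_mul_iff₀ hWn]
    linarith
  · rw [a1, a2, inv_mul_le_iff₀ hWn]
    linarith

/-- Closing lemma: a long segment of an orbit which nearly returns is shadowed by a closed
orbit. -/
lemma Seg.closing {xb yb δ : ℝ} {M : SLZ} {x y x' y' : ℝ} (h : Seg xb yb δ M x y x' y')
    (hδ : δ ≤ 1 / 100) (hw : 4 ≤ den M y) {c : ℝ} (hc : 0 ≤ c)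
    (hN : ∀ v : Fin 2 → ℤ, v ≠ 0 → |(v 1 : ℝ)| ≤ 8 * |ell y v| →
      x - y ≤ c * (|ell x v| * |ell y v|)) :
    ∃ X Y, Hyp M X Y ∧ |X - x| ≤ 8 * δ / den M y ^ 2 ∧ |Y - y'| ≤ 6 * δ / den M y ^ 2 ∧
      Good (c * (1 + 50 * δ) ^ 3) X Y ∧ den M y / 2 ≤ den M Y := by
  have hδ0 : 0 ≤ δ := (abs_nonneg _).trans h.hy
  obtain ⟨X, Y, hyp, hXx, hYy', hXx1, hYy, hXW, hW, hXY⟩ := h.exists_hyp hδ hw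
  refine ⟨X, Y, hyp, hXx, hYy', hyp.good_of_fundamental fun v hv h1 h2 => ?_, hW⟩
  have hWone : 1 ≤ den M Y ^ 2 := one_le_pow₀ hyp.one_lt.le
  set W2 := den M Y ^ 2 with hW2
  have e1 := sub_mul_abs_le (by linarith : Y ≤ X) v
  have hp : X - Y ≤ (1 + 5 * δ) * (x - y) := by
    have a1 := abs_le.1 hXx1
    have a2 := abs_le.1 hYy
    have a3 := abs_le.1 h.hx
    have a4 := abs_le.1 h.hy
    have hxy : 98 / 100 ≤ x - y := by linarith [a3.1, a4.2, h.base]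
    nlinarith [a1.2, a2.1]
  set q := |(v 1 : ℝ)| with hq
  have hq0 : 0 ≤ q := abs_nonneg _
  have hX0 := abs_nonneg (ell X v)
  have hY0 := abs_nonneg (ell Y v)
  -- On the fundamental domain the second entry is controlled by either linear form. Replacing `Y`
  -- by `y` then costs a relative error of order `δ`; for `X` and `x` the factor `W2` is absorbed by
  -- `hXW`.
  have q1 : q ≤ 9 / 4 * |ell Y v| := by nlinarith
  have q2 : q ≤ 9 / 4 * (W2 * |ell X v|) := by nlinarith
  have l1 : |ell x v| ≤ (1 + 50 * δ) * |ell X v| := by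
    refine abs_ell_le ?_
    have e4 : |X - x| * q ≤ |X - x| * (9 / 4 * (W2 * |ell X v|)) := by gcongr
    have e5 := mul_le_mul_of_nonneg_right hXW hX0
    have e6 := mul_nonneg hδ0 hX0
    rw [← hq]
    linarith
  have hYq : |Y - y| * q ≤ 7 * δ * |ell Y v| := by
    have e4 : |Y - y| * q ≤ 3 * δ * (9 / 4 * |ell Y v|) := by gcongr
    have e6 := mul_nonneg hδ0 hY0
    linarith
  have l2 := abs_ell_le hYq
  have l3 := le_abs_ell hYq
  have l3' : |ell Y v| * (9 / 10) ≤ |ell y v| := by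
    nlinarith [mul_le_mul_of_nonneg_right hδ hY0]
  have hgood := hN v hv (by rw [← hq]; linarith [abs_nonneg (ell y v)])
  have l4 : |ell x v| * |ell y v| ≤
      ((1 + 50 * δ) * |ell X v|) * ((1 + 7 * δ) * |ell Y v|) := by gcongr
  have l6 : (1 + 5 * δ) * (x - y) ≤ (1 + 5 * δ) *
      (c * (((1 + 50 * δ) * |ell X v|) * ((1 + 7 * δ) * |ell Y v|))) := by
    gcongr
    exact hgood.trans (mul_le_mul_of_nonneg_left l4 hc)
  refine (hp.trans l6).trans ?_
  have l7 : (1 + 5 * δ) * (1 + 50 * δ) * (1 + 7 * δ) ≤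
      (1 + 50 * δ) * (1 + 50 * δ) * (1 + 50 * δ) := by gcongr <;> norm_num
  have l8 : 0 ≤ c * (|ell X v| * |ell Y v|) := by positivity
  have l9 := mul_le_mul_of_nonneg_right l7 l8
  calc _ = (1 + 5 * δ) * (1 + 50 * δ) * (1 + 7 * δ) * (c * (|ell X v| * |ell Y v|)) := by ring
    _ ≤ _ := l9
    _ = _ := by ring

/-! ### Closed orbits near the base pair and their concatenation -/

/-- A closed orbit, given by a hyperbolic `M` with fixed points `X` and `Y`, which is long, passes
within `δ` of `(xb, yb)` and whose form is bounded below almost as well as possible. -/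
structure Closed (xb yb δ : ℝ) (M : SLZ) (X Y : ℝ) : Prop where
  base : 1 ≤ xb - yb
  hyp : Hyp M X Y
  hX : |X - xb| ≤ δ
  hY : |Y - yb| ≤ δ
  one_le : 1 ≤ δ * den M Y
  good : Good ((xb - yb) * (1 + δ)) X Y

namespace Closed

variable {xb yb δ : ℝ} {M S : SLZ} {X Y XS YS : ℝ}

lemma nonneg (h : Closed xb yb δ M X Y) : 0 ≤ δ := (abs_nonneg _).trans h.hX

lemma pos (h : Closed xb yb δ M X Y) : 0 < δ := by
  rcases h.nonneg.eq_or_lt with h0 | h0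
  · have := h.one_le
    rw [← h0] at this
    norm_num at this
  · exact h0

lemma seg (h : Closed xb yb δ M X Y) : Seg xb yb δ M X Y X Y :=
  ⟨h.base, h.hyp.mapsX, h.hyp.mapsY, h.hX, h.hY, h.hX, h.hY⟩

lemma flip (h : Closed xb yb δ M X Y) : Closed (-yb) (-xb) δ (flip M) (-Y) (-X) := by
  refine ⟨by linarith [h.base], h.hyp.flip, ?_, ?_, ?_, ?_⟩
  · rw [neg_sub_neg, abs_sub_comm]; exact h.hY
  · rw [neg_sub_neg, abs_sub_comm]; exact h.hX
  · rw [h.hyp.mapsX.flip_den, h.hyp.denX, inv_inv]; exact h.one_le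
  · have : -yb - -xb = xb - yb := by ring
    rw [this]
    exact h.good.flip

lemma mono {δ' : ℝ} (h : Closed xb yb δ' M X Y) (hδ : δ' ≤ δ) : Closed xb yb δ M X Y := by
  have h0 := h.nonneg
  refine ⟨h.base, h.hyp, h.hX.trans hδ, h.hY.trans hδ, h.one_le.trans ?_, fun v hv => ?_⟩
  · exact mul_le_mul_of_nonneg_right hδ h.hyp.pos.le
  · refine (h.good v hv).trans ?_
    have := h.base
    gcongr

lemma le_den (h : Closed xb yb δ M X Y) (hδ : δ ≤ 1 / 1000) : 1000 ≤ den M Y := by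
  have h1 := h.one_le
  have h2 := mul_le_mul_of_nonneg_right hδ h.hyp.pos.le
  linarith

lemma sub_bounds (h : Closed xb yb δ M X Y) (hδ : δ ≤ 1 / 1000) : 99 / 100 ≤ X - Y := by
  have a1 := abs_le.1 h.hX
  have a2 := abs_le.1 h.hY
  linarith [a1.1, a2.2, h.base]

lemma dist_le (hS : Closed xb yb δ S XS YS) (hM : Closed xb yb δ M X Y) :
    |XS - X| ≤ 2 * δ ∧ |Y - YS| ≤ 2 * δ := by
  constructor
  · refine (abs_sub_le _ xb _).trans ?_
    rw [abs_sub_comm xb]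
    linarith [hS.hX, hM.hX]
  · refine (abs_sub_le _ yb _).trans ?_
    rw [abs_sub_comm yb]
    linarith [hS.hY, hM.hY]

/-- Vectors whose minimum is governed by the `M` stretch of a concatenation: the condition `hc`
makes moving `X` to `x2` a relative change of at most `6δ` in `ell X v`. -/
lemma good_near (hM : Closed xb yb δ M X Y) (hδ : δ ≤ 1 / 1000) {x2 : ℝ}
    (hx2w : |x2 - X| * den M Y ^ 2 ≤ 6 * δ) (hx2δ : |x2 - X| ≤ δ) {v : Fin 2 → ℤ} (hv : v ≠ 0)
    (hc : |(v 1 : ℝ)| ≤ den M Y ^ 2 * |ell X v|) :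
    x2 - Y ≤ (xb - yb) * (1 + 20 * δ) ^ 3 * (|ell x2 v| * |ell Y v|) := by
  have hδ0 := hM.nonneg
  have hXY := hM.sub_bounds hδ
  have ha := hM.base
  have hX0 := abs_nonneg (ell X v)
  have h1 : |X - x2| * |(v 1 : ℝ)| ≤ 6 * δ * |ell X v| := by
    rw [abs_sub_comm]
    calc _ ≤ |x2 - X| * (den M Y ^ 2 * |ell X v|) := by gcongr
      _ = (|x2 - X| * den M Y ^ 2) * |ell X v| := by ring
      _ ≤ _ := by gcongr
  have h2 := le_abs_ell h1
  have h3 : |ell X v| ≤ (1 + 20 * δ) * |ell x2 v| := by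
    have h4 : (1 + 20 * δ) * ((1 - 6 * δ) * |ell X v|) ≤ (1 + 20 * δ) * |ell x2 v| := by
      gcongr
    have h5 : 1 ≤ (1 + 20 * δ) * (1 - 6 * δ) := by nlinarith
    nlinarith
  have h4 := hM.good v hv
  have h5 : x2 - Y ≤ (1 + 20 * δ) * (X - Y) := by
    have := (abs_le.1 hx2δ).2
    nlinarith
  calc x2 - Y ≤ (1 + 20 * δ) * (X - Y) := h5
    _ ≤ (1 + 20 * δ) * ((xb - yb) * (1 + δ) * (|ell X v| * |ell Y v|)) := by gcongr
    _ ≤ (1 + 20 * δ) * ((xb - yb) * (1 + 20 * δ) *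
        (((1 + 20 * δ) * |ell x2 v|) * |ell Y v|)) := by
      gcongr
      linarith
    _ = _ := by ring

/-- The complementary vectors belong to the `S` stretch. After applying `M`, the second entry is
controlled by `ell Y`, so the bound for `S` survives replacing `YS` by `Y`; the invariance of the
form carries it back. -/
lemma good_far (hS : Closed xb yb δ S XS YS) (hM : Closed xb yb δ M X Y) (hδ : δ ≤ 1 / 1000)
    {x2 : ℝ} (hx2 : Maps M x2 XS) (hd0 : 0 < den M x2) {v : Fin 2 → ℤ} (hv : v ≠ 0)
    (hq : |(v 1 : ℝ)| ≤ 8 * |ell Y v|) (hc : den M Y ^ 2 * |ell X v| < |(v 1 : ℝ)|) :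
    x2 - Y ≤ (xb - yb) * (1 + 20 * δ) ^ 3 * (|ell x2 v| * |ell Y v|) := by
  have hδ0 := hM.nonneg
  have hXY := hM.sub_bounds hδ
  have hXYS := hS.sub_bounds hδ
  have ha := hM.base
  have hw0 : 0 < den M Y := hM.hyp.pos
  have hYY := (hS.dist_le hM).2
  set v' := act M v with hv'
  have hv'0 : v' ≠ 0 := act_ne_zero M hv
  have eX : |ell X v'| = den M Y * |ell X v| := by
    rw [hv', hM.hyp.ellX_act, abs_mul, abs_of_pos hw0]
  have eY : den M Y * |ell Y v'| = |ell Y v| := by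
    rw [hv', hM.hyp.ellY_act, abs_mul, abs_of_pos (inv_pos.2 hw0),
      mul_inv_cancel_left₀ hw0.ne']
  have ex : |ell XS v'| * den M x2 = |ell x2 v| := by
    rw [← hx2.ell_act v, abs_mul, abs_of_pos hd0]
  have h1 : |ell X v'| ≤ 8 * |ell Y v'| := by
    have : den M Y * (den M Y * |ell X v|) ≤ den M Y * (8 * |ell Y v'|) := by
      have e1 : den M Y * (den M Y * |ell X v|) = den M Y ^ 2 * |ell X v| := by ring
      have e2 : den M Y * (8 * |ell Y v'|) = 8 * (den M Y * |ell Y v'|) := by ring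
      rw [e1, e2, eY]
      linarith
    rw [eX]
    exact le_of_mul_le_mul_left this hw0
  have h2 := sub_mul_abs_le (by linarith : Y ≤ X) v'
  have hq0 := abs_nonneg (v' 1 : ℝ)
  have h3 : |(v' 1 : ℝ)| ≤ 10 * |ell Y v'| := by nlinarith
  have h4 : |Y - YS| * |(v' 1 : ℝ)| ≤ 20 * δ * |ell Y v'| := by
    calc _ ≤ (2 * δ) * (10 * |ell Y v'|) := by gcongr
      _ = _ := by ring
  have h5 := abs_ell_le h4
  have h6 := hS.good v' hv'0
  have h7 := hx2.sub hM.hyp.mapsY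
  have h8 : XS - Y ≤ (1 + 20 * δ) * (XS - YS) := by
    have := (abs_le.1 hYY).1
    nlinarith
  have hD : 0 < den M x2 * den M Y := mul_pos hd0 hw0
  have h9 : XS - Y ≤ (1 + 20 * δ) * ((xb - yb) * (1 + 20 * δ) *
        (|ell XS v'| * ((1 + 20 * δ) * |ell Y v'|))) := by
    refine h8.trans ?_
    gcongr
    refine h6.trans ?_
    gcongr
    · linarith
  calc x2 - Y = (XS - Y) * (den M x2 * den M Y) := h7.symm
    _ ≤ ((1 + 20 * δ) * ((xb - yb) * (1 + 20 * δ) *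
        (|ell XS v'| * ((1 + 20 * δ) * |ell Y v'|)))) * (den M x2 * den M Y) := by gcongr
    _ = (xb - yb) * (1 + 20 * δ) ^ 3 *
        ((|ell XS v'| * den M x2) * (den M Y * |ell Y v'|)) := by ring
    _ = _ := by rw [ex, eY]

/-- Two closed orbits passing near the same point can be concatenated. -/
lemma concat (hS : Closed xb yb δ S XS YS) (hM : Closed xb yb δ M X Y) (hδ : δ ≤ 1 / 1000) :
    ∃ X' Y' t, Hyp (S * M) X' Y' ∧ Good ((xb - yb) * (1 + 100 * δ) ^ 7) X' Y' ∧
      |X' - X| ≤ 22 * δ / den M Y ^ 2 ∧ Maps S Y t ∧ |Y' - t| ≤ 12 * δ / den M Y ^ 2 := by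
  have hδ0 := hS.nonneg
  have hwS := hS.le_den hδ
  have hwM := hM.le_den hδ
  have hw0 : 0 < den M Y := by linarith
  obtain ⟨hXX, hYY⟩ := hS.dist_le hM
  obtain ⟨x2, hx2, hx2X, hd0, -⟩ := hM.seg.exists_maps_near' (by linarith) (by linarith)
    (z' := XS) (by linarith)
  obtain ⟨t, ht, htY⟩ := hS.seg.exists_maps_near (by linarith) (by linarith)
    (z := Y) (by linarith)
  have hdS := (hS.seg.den_near (by linarith) (by linarith) (z := Y) (by linarith)).1
  have hsqM : 1000000 ≤ den M Y ^ 2 := by nlinarith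
  have hx2X' : |x2 - X| ≤ 6 * δ / den M Y ^ 2 := by
    refine hx2X.trans (div_le_div_of_nonneg_right ?_ (by positivity))
    linarith
  have hx2w : |x2 - X| * den M Y ^ 2 ≤ 6 * δ := by
    rwa [le_div_iff₀ (by positivity)] at hx2X'
  have hx2δ : |x2 - X| ≤ δ := by nlinarith [abs_nonneg (x2 - X)]
  have htδ : |t - YS| ≤ δ := by
    refine htY.trans ?_
    rw [div_le_iff₀ (by positivity)]
    have : 4 ≤ den S YS ^ 2 := by nlinarith
    nlinarith
  -- The concatenated segment runs from `(x2, Y)` through `(XS, Y)` to `(XS, t)`.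
  have seg : Seg xb yb (2 * δ) (S * M) x2 Y XS t := by
    refine ⟨hS.base, hx2.mul hS.hyp.mapsX, hM.hyp.mapsY.mul ht, ?_, ?_, ?_, ?_⟩
    · refine (abs_sub_le _ X _).trans ?_
      linarith [hM.hX]
    · linarith [hM.hY]
    · linarith [hS.hX]
    · refine (abs_sub_le _ YS _).trans ?_
      linarith [hS.hY]
  have hden : den (S * M) Y = den S Y * den M Y := hM.hyp.mapsY.mul_den
  have hdenle : den M Y ≤ den (S * M) Y := by rw [hden]; nlinarith
  have ha := hS.base
  have key : ∀ v : Fin 2 → ℤ, v ≠ 0 → |(v 1 : ℝ)| ≤ 8 * |ell Y v| →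
      x2 - Y ≤ (xb - yb) * (1 + 20 * δ) ^ 3 * (|ell x2 v| * |ell Y v|) := by
    intro v hv hq
    rcases le_or_gt |(v 1 : ℝ)| (den M Y ^ 2 * |ell X v|) with hc | hc
    · exact hM.good_near hδ hx2w hx2δ hv hc
    · exact hS.good_far hM hδ hx2 hd0 hv hq hc
  obtain ⟨X', Y', hyp, h1, h2, h3, -⟩ := seg.closing (by linarith) (by linarith)
    (mul_nonneg (by linarith) (by positivity)) key
  have hsq : den M Y ^ 2 ≤ den (S * M) Y ^ 2 := by gcongr
  refine ⟨X', Y', t, hyp, ?_, ?_, ht, ?_⟩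
  · intro v hv
    refine (h3 v hv).trans ?_
    refine mul_le_mul_of_nonneg_right ?_ (by positivity)
    rw [mul_assoc]
    refine mul_le_mul_of_nonneg_left ?_ (by linarith)
    have e : 50 * (2 * δ) = 100 * δ := by ring
    rw [e]
    calc (1 + 20 * δ) ^ 3 * (1 + 100 * δ) ^ 3
        ≤ (1 + 100 * δ) ^ 3 * (1 + 100 * δ) ^ 3 := by gcongr; norm_num
      _ = (1 + 100 * δ) ^ 6 := by ring
      _ ≤ (1 + 100 * δ) ^ 7 := pow_le_pow_right₀ (by linarith) (by norm_num)
  · have h4 : 8 * (2 * δ) / den (S * M) Y ^ 2 ≤ 8 * (2 * δ) / den M Y ^ 2 := by gcongr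
    refine (abs_sub_le _ x2 _).trans ((add_le_add (h1.trans h4) hx2X').trans ?_)
    rw [← add_div]
    gcongr
    linarith
  · refine h2.trans ?_
    have h4 : 6 * (2 * δ) / den (S * M) Y ^ 2 ≤ 6 * (2 * δ) / den M Y ^ 2 := by gcongr
    refine h4.trans (le_of_eq ?_)
    ring

end Closed

lemma exists_maps_close {M : SLZ} {y y' ε : ℝ} (h : Maps M y y') (hε : 0 < ε) :
    ∃ η > 0, ∀ r, |r - y| ≤ η → ∃ r', Maps M r r' ∧ |r' - y'| ≤ ε := by
  have hd : den M y ≠ 0 := h.1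
  have c1 : Continuous (den M) := by unfold den; fun_prop
  have c2 : ContinuousAt (fun r => ((M 0 0 : ℝ) * r + (M 0 1 : ℝ)) / den M r) y :=
    ContinuousAt.div (by fun_prop) c1.continuousAt hd
  have e1 : ∀ᶠ r in nhds y, den M r ≠ 0 := c1.continuousAt.eventually_ne hd
  have e2 : ∀ᶠ r in nhds y, ((M 0 0 : ℝ) * r + (M 0 1 : ℝ)) / den M r ∈ Metric.closedBall y' ε := by
    refine c2 ?_
    show _ ∈ nhds (((M 0 0 : ℝ) * y + (M 0 1 : ℝ)) / den M y)
    rw [← h.eq_div]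
    exact Metric.closedBall_mem_nhds _ hε
  obtain ⟨η, hη, hball⟩ := Metric.eventually_nhds_iff.1 (e1.and e2)
  refine ⟨η / 2, by positivity, fun r hr => ?_⟩
  obtain ⟨g1, g2⟩ := hball (y := r) (by rw [Real.dist_eq]; linarith)
  obtain ⟨r', hr'⟩ := exists_maps g1
  refine ⟨r', hr', ?_⟩
  rw [← hr'.eq_div] at g2
  simpa [Real.dist_eq] using g2

/-! ### Rigidity forced by the gap -/

/-- Every closed orbit whose form is bounded below by `c⁻¹` with `c < b` has width at most `a`. -/
def GapAt (a b : ℝ) : Prop :=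
  ∀ (M : SLZ) (X Y c : ℝ), Hyp M X Y → Y < X → 0 < c → c < b → Good c X Y → X - Y ≤ a

lemma GapAt.sub_le {a b : ℝ} (hgap : GapAt a b) {M : SLZ} {X Y c : ℝ} (h : Hyp M X Y)
    (hc : 0 < c) (hcb : c < b) (hg : Good c X Y) (ha : 0 ≤ a) : X - Y ≤ a := by
  rcases lt_or_ge Y X with hlt | hge
  · exact hgap M X Y c h hlt hc hcb hg
  · linarith

section

variable {xb yb b δ₀ : ℝ}

/-- An element of a long closed orbit cannot move `yb` to the left, since otherwise a
concatenation would yield a value of the spectrum inside the gap. -/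
lemma Closed.le_of_maps (hgap : GapAt (xb - yb) b)
    (hrec : ∀ δ > 0, ∃ M X Y, Closed xb yb δ M X Y) (hδ : δ₀ ≤ 1 / 1000)
    (hb : (xb - yb) * (1 + 100 * δ₀) ^ 7 < b) {S : SLZ} {XS YS : ℝ}
    (hS : Closed xb yb δ₀ S XS YS) {t : ℝ} (ht : Maps S yb t) : yb ≤ t := by
  have hδ0 := hS.pos
  refine le_of_forall_pos_le_add fun ε hε => ?_
  obtain ⟨M, X, Y, hM⟩ := hrec (min δ₀ (ε / 4)) (lt_min hδ0 (by positivity))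
  set δ' := min δ₀ (ε / 4) with hδ'
  have hle : δ' ≤ δ₀ := min_le_left _ _
  have hle2 : δ' ≤ ε / 4 := min_le_right _ _
  have hpos : 0 < δ' := hM.pos
  obtain ⟨X', Y', t', hyp, hg, hX', ht', hY'⟩ := hS.concat (hM.mono hle) hδ
  have hwM := hM.le_den (hle.trans hδ)
  have hw0 : 0 < den M Y := by linarith
  have hb1 := hS.base
  -- The gap bounds the width of `S * M`. Its endpoints are close to `xb` and `t`, so `xb - t` can
  -- exceed `xb - yb` by at most the four errors of size `δ'`.
  have h1 := hgap.sub_le hyp (mul_pos (by linarith) (by positivity)) hb hg (by linarith)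
  -- A closed orbit within `δ'` of the base also has `den M Y ≥ 1/δ'`, so the concatenation error,
  -- although built from `δ₀`, is below `δ'`.
  have h2 : 22 * δ₀ / den M Y ^ 2 ≤ δ' := by
    rw [div_le_iff₀ (by positivity)]
    have := mul_le_mul hM.one_le hwM (by norm_num) (mul_nonneg hpos.le hw0.le)
    nlinarith
  have h3 : 12 * δ₀ / den M Y ^ 2 ≤ δ' := by
    refine le_trans ?_ h2
    gcongr
    norm_num
  have hwS := hS.le_den hδ
  have d1 := (hS.seg.den_near (by linarith) (by linarith) (z := Y) (by
    refine (abs_sub_le _ yb _).trans ?_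
    rw [abs_sub_comm yb]
    linarith [hM.hY, hS.hY])).1
  have d2 := (hS.seg.den_near (by linarith) (by linarith) (z := yb) (by
    rw [abs_sub_comm]
    linarith [hS.hY])).1
  have h4 : |t' - t| ≤ δ' := by
    have e := ht'.sub ht
    have e1 : |t' - t| * (den S Y * den S yb) = |Y - yb| := by
      rw [← e, abs_mul, abs_of_pos (mul_pos (by linarith) (by linarith) :
        0 < den S Y * den S yb)]
    have e2 : 1 ≤ den S Y * den S yb := by nlinarith
    have := hM.hY
    nlinarith [abs_nonneg (t' - t)]
  have g1 := abs_le.1 (hX'.trans h2)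
  have g2 := abs_le.1 (hY'.trans h3)
  have g3 := abs_le.1 h4
  have g4 := abs_le.1 hM.hX
  linarith [g1.1, g2.2, g3.2, g4.1]

/-- If the inverse of an element of a long closed orbit moves `yb` only slightly, then not to the
left. -/
lemma Closed.le_of_maps_inv (hgap : GapAt (xb - yb) b)
    (hrec : ∀ δ > 0, ∃ M X Y, Closed xb yb δ M X Y) (hδ : δ₀ ≤ 1 / 1000)
    (hb : (xb - yb) * (1 + 100 * δ₀) ^ 7 < b) {S : SLZ} {XS YS : ℝ}
    (hS : Closed xb yb δ₀ S XS YS) {z : ℝ} (hz : Maps S z yb) (hzy : |z - yb| ≤ δ₀) :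
    yb ≤ z := by
  have hδ0 := hS.pos
  have hwS := hS.le_den hδ
  have hb1 := hS.base
  refine le_of_forall_pos_le_add fun ε hε => ?_
  obtain ⟨ε', hε', hε1, hε2, hε3⟩ : ∃ ε' : ℝ, 0 < ε' ∧ ε' ≤ ε / 4 ∧ ε' ≤ δ₀ ∧ ε' ≤ 1 / 4 :=
    ⟨min (ε / 4) (min δ₀ (1 / 4)), by positivity, min_le_left _ _,
      (min_le_right _ _).trans (min_le_left _ _), (min_le_right _ _).trans (min_le_right _ _)⟩
  obtain ⟨η, hη, hclose⟩ := exists_maps_close hz.inv hε'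
  -- `M` is taken so much longer than `S` that `S⁻¹ * M` still has denominator at least `1/ε'`; its
  -- fixed points are then close to `xb` and `z`.
  obtain ⟨δ', hδ', h1, h2, h3⟩ : ∃ δ' : ℝ, 0 < δ' ∧ δ' ≤ η ∧ δ' ≤ ε' ∧
      δ' * (2 * den S YS) ≤ ε' := by
    refine ⟨min η (min ε' (ε' / (2 * den S YS))), ?_, min_le_left _ _,
      (min_le_right _ _).trans (min_le_left _ _), ?_⟩
    · have : 0 < den S YS := by linarith
      positivity
    · rw [← le_div_iff₀ (by linarith)]
      exact (min_le_right _ _).trans (min_le_right _ _)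
  obtain ⟨M, X, Y, hM⟩ := hrec δ' hδ'
  have hM' := hM.mono (h2.trans hε2)
  have hw0 := hM.hyp.pos
  obtain ⟨y1, hy1', hy1z⟩ := hclose Y (hM.hY.trans h1)
  have hy1 := hy1'.of_inv
  have hXX : |X - XS| ≤ 2 * δ₀ := by
    refine (abs_sub_le _ xb _).trans ?_
    rw [abs_sub_comm xb]
    linarith [hS.hX, hM'.hX]
  obtain ⟨x1, hx1, hx1X, -, -⟩ := hS.seg.exists_maps_near' (by linarith) (by linarith)
    (z' := X) (by linarith)
  have hx1δ : |x1 - XS| ≤ δ₀ := by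
    refine hx1X.trans ?_
    rw [div_le_iff₀ (by positivity)]
    have : 6 ≤ den S YS ^ 2 := by nlinarith
    nlinarith
  have hy1b : |y1 - yb| ≤ 2 * δ₀ := by
    refine (abs_sub_le _ z _).trans ?_
    linarith
  have seg : Seg xb yb (2 * δ₀) (S⁻¹ * M) X Y x1 y1 := by
    refine ⟨hb1, hM.hyp.mapsX.mul hx1.inv, hM.hyp.mapsY.mul hy1.inv, ?_, ?_, ?_, hy1b⟩
    · linarith [hM'.hX]
    · linarith [hM'.hY]
    · refine (abs_sub_le _ XS _).trans ?_
      linarith [hS.hX]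
  have hd := hS.seg.den_near (by linarith) (by linarith) (z := y1) (by
    refine (abs_sub_le _ yb _).trans ?_
    rw [abs_sub_comm yb]
    linarith [hS.hY])
  have hdpos : 0 < den S y1 := by linarith [hd.1]
  have hden : den (S⁻¹ * M) Y = (den S y1)⁻¹ * den M Y := by
    rw [hM.hyp.mapsY.mul_den, hy1.inv_den]
  have hw : 1 ≤ ε' * den (S⁻¹ * M) Y := by
    rw [hden, mul_left_comm, ← div_eq_inv_mul, le_div_iff₀ hdpos, one_mul]
    have e1 : δ' * (2 * den S YS) * den M Y ≤ ε' * den M Y := by gcongr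
    have e2 : 1 * (2 * den S YS) ≤ δ' * den M Y * (2 * den S YS) := by
      exact mul_le_mul_of_nonneg_right hM.one_le (by linarith)
    linarith [hd.2]
  set w := den (S⁻¹ * M) Y with hwdef
  have hw1 : 4 ≤ w := by
    by_contra hc
    push Not at hc
    have : ε' * w < ε' * 4 := by gcongr
    linarith
  have hcpos : 0 < (xb - yb) * (1 + δ₀) := mul_pos (by linarith) (by linarith)
  obtain ⟨X', Y', hyp, hX', hY', hg, -⟩ := seg.closing (by linarith) hw1
    hcpos.le (fun v hv _ => hM'.good v hv)
  have hle := hgap.sub_le hyp (by positivity) (lt_of_le_of_lt ?_ hb) hg (by linarith)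
  · have e1 : 8 * (2 * δ₀) / w ^ 2 ≤ ε' := by
      rw [div_le_iff₀ (by positivity)]
      nlinarith
    have e2 : 6 * (2 * δ₀) / w ^ 2 ≤ ε' := by
      rw [div_le_iff₀ (by positivity)]
      nlinarith
    have g1 := abs_le.1 (hX'.trans e1)
    have g2 := abs_le.1 (hY'.trans e2)
    have g3 := abs_le.1 hy1z
    have g4 := abs_le.1 hM.hX
    linarith [g1.1, g2.2, g3.2, g4.1]
  · rw [mul_assoc]
    refine mul_le_mul_of_nonneg_left ?_ (by linarith)
    have e : 50 * (2 * δ₀) = 100 * δ₀ := by ring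
    rw [e]
    calc (1 + δ₀) * (1 + 100 * δ₀) ^ 3
        ≤ (1 + 100 * δ₀) * (1 + 100 * δ₀) ^ 3 := by gcongr; linarith
      _ = (1 + 100 * δ₀) ^ 4 := by ring
      _ ≤ (1 + 100 * δ₀) ^ 7 := pow_le_pow_right₀ (by linarith) (by norm_num)

/-- If an element of a long closed orbit maps a point slightly to the left of `yb` to a point to
the left of `yb`, then it fixes `yb`. -/
lemma Closed.eq_base (hgap : GapAt (xb - yb) b)
    (hrec : ∀ δ > 0, ∃ M X Y, Closed xb yb δ M X Y) (hδ : δ₀ ≤ 1 / 1000)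
    (hb : (xb - yb) * (1 + 100 * δ₀) ^ 7 < b) {S : SLZ} {XS YS : ℝ}
    (hS : Closed xb yb δ₀ S XS YS) {u u' : ℝ} (hu : Maps S u u') (huy : u ≤ yb)
    (huδ : |u - yb| ≤ δ₀) (hu' : u' ≤ yb) : YS = yb := by
  have hδ0 := hS.pos
  have hwS := hS.le_den hδ
  have hyS := hS.hY
  have hnear : ∀ z ∈ Set.Icc u yb, 500 ≤ den S z := by
    intro z hz
    have := (hS.seg.den_near (by linarith) (by linarith) (z := z) (by
      refine (abs_sub_le _ yb _).trans ?_
      rw [abs_sub_comm yb]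
      have : |z - yb| ≤ δ₀ := by
        rw [abs_le] at huδ ⊢
        constructor <;> linarith [hz.1, hz.2, huδ.1]
      linarith)).1
    linarith
  have hyb := hnear yb ⟨huy, le_rfl⟩
  obtain ⟨t, ht⟩ := exists_maps (M := S) (x := yb) (by linarith)
  have hle := hS.le_of_maps hgap hrec hδ hb ht
  have hcont : ContinuousOn (fun z => ((S 0 0 : ℝ) * z + (S 0 1 : ℝ)) / den S z)
      (Set.Icc u yb) := by
    have : ∀ z ∈ Set.Icc u yb, den S z ≠ 0 := fun z hz => by linarith [hnear z hz]
    unfold den at this ⊢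
    fun_prop (disch := assumption)
  -- `S` sends `u` to the left of `yb` and `yb` not to the left, so some `z` in between is sent to
  -- `yb`. The bound for the inverse leaves only `z = yb`.
  obtain ⟨z, hz, hzy⟩ := intermediate_value_Icc huy hcont
    (show yb ∈ Set.Icc _ _ from by
      show yb ∈ Set.Icc (((S 0 0 : ℝ) * u + (S 0 1 : ℝ)) / den S u)
        (((S 0 0 : ℝ) * yb + (S 0 1 : ℝ)) / den S yb)
      rw [← hu.eq_div, ← ht.eq_div]
      exact ⟨hu', hle⟩)
  have hmz : Maps S z yb := by
    have hne : den S z ≠ 0 := by linarith [hnear z hz]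
    refine ⟨hne, ?_⟩
    rw [← hzy]
    exact (div_mul_cancel₀ _ hne).symm
  have hzge := hS.le_of_maps_inv hgap hrec hδ hb hmz (by
    rw [abs_le] at huδ ⊢
    constructor <;> linarith [hz.1, hz.2, huδ.1])
  have hzeq : z = yb := le_antisymm hz.2 hzge
  rw [hzeq] at hmz
  -- Two distinct fixed points would have denominators with product 1, but both are large.
  have e := hS.hyp.mapsY.sub hmz
  by_contra hne
  have hne' : YS - yb ≠ 0 := sub_ne_zero.2 hne
  have : den S YS * den S yb = 1 := mul_left_cancel₀ hne' (by linarith)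
  nlinarith

lemma Hyp.symm_relations {M : SLZ} {X Y : ℝ} (h : Hyp M X Y) :
    (M 1 0 : ℝ) ≠ 0 ∧ (M 1 0 : ℝ) * (X + Y) = (M 0 0 : ℝ) - M 1 1 ∧
      (M 1 0 : ℝ) * (X * Y) = - (M 0 1 : ℝ) := by
  have h1 := h.mapsX.2
  have h2 := h.mapsY.2
  have hne : X - Y ≠ 0 := sub_ne_zero.2 h.ne
  simp only [den] at h1 h2
  have e1 : (M 1 0 : ℝ) * (X + Y) = (M 0 0 : ℝ) - M 1 1 := by
    apply mul_left_cancel₀ hne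
    linear_combination h2 - h1
  refine ⟨fun h0 => ?_, e1, ?_⟩
  · have h3 := h.denX
    have h4 := h.one_lt
    have h5 := inv_lt_one_of_one_lt₀ h4
    simp only [den, h0, zero_mul, zero_add] at h3 h4 h5
    linarith
  · linear_combination X * e1 + h1

/-- The conjugate fixed point is determined by the other one. -/
lemma Hyp.conj_unique {M M' : SLZ} {X X' Y : ℝ} (h : Hyp M X Y) (h' : Hyp M' X' Y) : X = X' := by
  obtain ⟨c0, s, p⟩ := h.symm_relations
  obtain ⟨c0', s', p'⟩ := h'.symm_relations
  by_contra hne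
  have hY := h.inv.irrational
  have hne' : X - X' ≠ 0 := sub_ne_zero.2 hne
  -- Sums and products of conjugate fixed points are rational. If `X ≠ X'`, then `X - X'` and `Y *
  -- (X - X')` are rational and the first is nonzero, so `Y` would be rational.
  have e1 : (X - X') * ((M 1 0 : ℝ) * M' 1 0) =
      ((M 0 0 - M 1 1) * M' 1 0 - (M' 0 0 - M' 1 1) * M 1 0 : ℝ) := by
    linear_combination (M' 1 0 : ℝ) * s - (M 1 0 : ℝ) * s'
  have e2 : Y * ((X - X') * ((M 1 0 : ℝ) * M' 1 0)) =
      (- (M 0 1) * M' 1 0 + M' 0 1 * M 1 0 : ℝ) := by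
    linear_combination (M' 1 0 : ℝ) * p - (M 1 0 : ℝ) * p'
  have e3 : (X - X') * ((M 1 0 : ℝ) * M' 1 0) ≠ 0 := mul_ne_zero hne' (mul_ne_zero c0 c0')
  refine hY ⟨((- (M 0 1) * M' 1 0 + M' 0 1 * M 1 0 : ℤ) : ℚ) /
    (((M 0 0 - M 1 1) * M' 1 0 - (M' 0 0 - M' 1 1) * M 1 0 : ℤ) : ℚ), ?_⟩
  push_cast
  rw [← e1, ← e2]
  field_simp

/-- By `Hyp.conj_unique` the repelling point does not depend on `δ`, and it lies within every `δ` of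
`xb`. -/
lemma eq_of_closed_base (h : ∀ δ > 0, ∃ S X, Closed xb yb δ S X yb) {δ : ℝ} (hδ : 0 < δ) :
    ∃ S, Closed xb yb δ S xb yb := by
  obtain ⟨S, X, hS⟩ := h δ hδ
  have : X = xb := by
    rw [← sub_eq_zero, ← abs_eq_zero]
    refine le_antisymm (le_of_forall_pos_le_add fun ε hε => ?_) (abs_nonneg _)
    obtain ⟨S', X', hS'⟩ := h ε hε
    rw [hS.hyp.conj_unique hS'.hyp]
    linarith [hS'.hX]
  subst this
  exact ⟨S, hS⟩

/-- If a bi-infinite limit orbit of width `xb - yb` is approached from outside by an orbit, then it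
is closed, provided that there is a gap above `xb - yb`. -/
lemma exists_closed_base (hgap : GapAt (xb - yb) b) (hbase : 1 ≤ xb - yb) (hab : xb - yb < b)
    {x y : ℕ → ℝ} (hx : Tendsto x atTop (nhds xb)) (hy : Tendsto y atTop (nhds yb))
    (hxy : ∀ k, xb - yb ≤ x k - y k)
    (hclosed : ∀ δ > 0, ∀ᶠ k in atTop, ∀ᶠ l in atTop, ∃ S X Y, Closed xb yb δ S X Y ∧
      Maps S (x k) (x l) ∧ Maps S (y k) (y l)) {δ : ℝ} (hδ : 0 < δ) :
    ∃ S, Closed xb yb δ S xb yb := by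
  have hrec : ∀ δ > 0, ∃ M X Y, Closed xb yb δ M X Y := by
    intro δ hδ
    obtain ⟨k, hk⟩ := (hclosed δ hδ).exists
    obtain ⟨l, S, X, Y, h, -, -⟩ := hk.exists
    exact ⟨S, X, Y, h⟩
  have hrec' : ∀ δ > 0, ∃ M X Y, Closed (-yb) (-xb) δ M X Y := by
    intro δ hδ
    obtain ⟨M, X, Y, h⟩ := hrec δ hδ
    exact ⟨_, _, _, h.flip⟩
  have hneg : -yb - -xb = xb - yb := by ring
  have hgap' : GapAt (-yb - -xb) b := by rwa [hneg]
  obtain ⟨δ₀, hδ₀, hδ₀1, hδ₀b⟩ : ∃ δ₀ : ℝ, 0 < δ₀ ∧ δ₀ ≤ 1 / 1000 ∧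
      (xb - yb) * (1 + 100 * δ₀) ^ 7 < b := by
    have hc : Tendsto (fun d : ℝ => (xb - yb) * (1 + 100 * d) ^ 7) (nhds 0)
        (nhds ((xb - yb) * (1 + 100 * 0) ^ 7)) := by
      apply Continuous.tendsto
      fun_prop
    have h1 := hc.eventually (gt_mem_nhds (by simpa using hab : _ < b))
    obtain ⟨η, hη, hball⟩ := Metric.eventually_nhds_iff.1 h1
    refine ⟨min (η / 2) (1 / 1000), by positivity, min_le_right _ _, hball ?_⟩
    rw [dist_zero_right, Real.norm_of_nonneg (by positivity)]
    exact (min_le_left _ _).trans_lt (by linarith)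
  -- Width at least `xb - yb` means that `y k > yb` forces `x k > xb`. The second case is the time
  -- reversal of the first.
  by_cases hfreq : ∃ᶠ k in atTop, y k ≤ yb
  · refine eq_of_closed_base (fun δ' hδ' => ?_) hδ
    have e1 : ∀ᶠ k in atTop, |y k - yb| ≤ δ₀ :=
      (tendsto_iff_dist_tendsto_zero.1 hy).eventually (ge_mem_nhds hδ₀)
    obtain ⟨k, hk, hkδ, hkc⟩ :=
      (hfreq.and_eventually (e1.and (hclosed _ (lt_min hδ' hδ₀)))).exists
    obtain ⟨l, hl, S, X, Y, hS, -, hSy⟩ := (hfreq.and_eventually hkc).exists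
    have := (hS.mono (min_le_right _ _)).eq_base hgap hrec hδ₀1 hδ₀b hSy hk hkδ hl
    subst this
    exact ⟨S, X, hS.mono (min_le_left _ _)⟩
  · have hev : ∀ᶠ k in atTop, xb ≤ x k := by
      filter_upwards [not_frequently.1 hfreq] with k hk
      linarith [hxy k]
    obtain ⟨S, hS⟩ := eq_of_closed_base (xb := -yb) (yb := -xb) (δ := δ) (fun δ' hδ' => by
      have e1 : ∀ᶠ k in atTop, |x k - xb| ≤ δ₀ :=
        (tendsto_iff_dist_tendsto_zero.1 hx).eventually (ge_mem_nhds hδ₀)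
      obtain ⟨k, hk, hkc⟩ := (hev.and (hclosed _ (lt_min hδ' hδ₀))).exists
      obtain ⟨l, hl, hlδ, S, X, Y, hS, hSx, -⟩ := (hev.and (e1.and hkc)).exists
      have := (hS.mono (min_le_right _ _)).flip.eq_base hgap' hrec' hδ₀1 (by rwa [hneg])
        hSx.flip (by linarith) (by rwa [neg_sub_neg, abs_sub_comm]) (by linarith)
      refine ⟨flip S, -Y, ?_⟩
      have h2 := hS.flip.mono (min_le_left _ _)
      rwa [this] at h2) hδ
    refine ⟨flip S, ?_⟩
    simpa using hS.flip

end

/-! ### Frames at rational approximations -/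

/-- The modular transformation `g` sends `∞` to a rational number with denominator `g 1 0`; the
points `x` and `y` are the preimages of `α` and `∞`. -/
structure Frame (α : ℝ) (g : SLZ) (x y : ℝ) : Prop where
  q_pos : (0 : ℝ) < g 1 0
  maps : Maps g x α
  den_pos : 0 < den g x
  y_eq : y * g 1 0 = - (g 1 1 : ℝ)

namespace Frame

variable {α x y x' y' : ℝ} {g h : SLZ}

lemma sub_mul (hg : Frame α g x y) : (x - y) * g 1 0 = den g x := by
  simp only [den]
  linear_combination -hg.y_eq

lemma act_apply_one (hg : Frame α g x y) (v : Fin 2 → ℤ) :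
    ((act g v 1 : ℤ) : ℝ) = g 1 0 * ell y v := by
  simp only [act, ell, Matrix.cons_val_one, Int.cast_add, Int.cast_mul, Matrix.cons_val_zero]
  linear_combination (v 1 : ℝ) * hg.y_eq

/-- As `y` corresponds to `∞`, `ell y` measures denominators. Approximation values of `α` thus
become values of the normalized form with roots `x` and `y`. -/
lemma mul_abs (hg : Frame α g x y) (v : Fin 2 → ℤ) :
    (x - y) * (|((act g v 1 : ℤ) : ℝ)| * |ell α (act g v)|) = |ell x v| * |ell y v| := by
  rw [hg.act_apply_one, abs_mul, abs_of_pos hg.q_pos, ← hg.maps.ell_act v, abs_mul,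
    abs_of_pos hg.den_pos, ← hg.sub_mul]
  ring

/-- The length of a transition is read off from the ratio of the two denominators, so distant
approximations give long segments. -/
lemma den_trans (hg : Frame α g x y) : den (h⁻¹ * g) y = h 1 0 / g 1 0 := by
  rw [eq_div_iff hg.q_pos.ne']
  obtain ⟨-, -, h10, h11⟩ := inv_entries h
  have e := det_eq_real g
  have e2 := hg.y_eq
  simp only [den, mul_entry, h10, h11, Int.cast_add, Int.cast_mul, Int.cast_neg]
  linear_combination (-(h 1 0) * (g 0 0) + (h 0 0) * (g 1 0) : ℝ) * e2 + (h 1 0 : ℝ) * e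

lemma maps_trans_y (hg : Frame α g x y) (hh : Frame α h x' y') : Maps (h⁻¹ * g) y y' := by
  have hq := hg.q_pos.ne'
  have hq' := hh.q_pos.ne'
  refine ⟨by rw [hg.den_trans]; exact div_ne_zero hq' hq, ?_⟩
  rw [hg.den_trans, ← mul_div_assoc, hh.y_eq, eq_div_iff hq]
  obtain ⟨h00, h01, -, -⟩ := inv_entries h
  have e := det_eq_real g
  have e2 := hg.y_eq
  simp only [mul_entry, h00, h01, Int.cast_add, Int.cast_mul, Int.cast_neg]
  linear_combination ((h 1 1) * (g 0 0) - (h 0 1) * (g 1 0) : ℝ) * e2 - (h 1 1 : ℝ) * e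

lemma maps_trans_x (hg : Frame α g x y) (hh : Frame α h x' y') : Maps (h⁻¹ * g) x x' :=
  hg.maps.mul hh.maps.inv

end Frame

/-- A frame at a reduced fraction to the right of `α`, with `y` in the unit interval. -/
lemma exists_frame {α : ℝ} {v : Fin 2 → ℤ} (hco : IsCoprime (v 0) (v 1)) (hq : 0 < v 1)
    (hell : 0 < ell α v) :
    ∃ g x y, Frame α g x y ∧ g 1 0 = v 1 ∧ 0 ≤ y ∧ y ≤ 1 ∧ x - y = (v 1 * ell α v)⁻¹ := by
  obtain ⟨s, w, hsw⟩ := hco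
  have hqR : (0 : ℝ) < v 1 := by exact_mod_cast hq
  -- The choice of Bézout pair is a translation of the frame; this one makes `y` a fractional part.
  set t : ℤ := ⌊-(s : ℝ) / v 1⌋ with ht
  let g : SLZ := ⟨!![v 0, -w + t * v 0; v 1, s + t * v 1], by
    rw [Matrix.det_fin_two_of]
    linear_combination hsw⟩
  have g00 : g 0 0 = v 0 := rfl
  have g01 : g 0 1 = -w + t * v 0 := rfl
  have g10 : g 1 0 = v 1 := rfl
  have g11 : g 1 1 = s + t * v 1 := rfl
  obtain ⟨-, -, i10, i11⟩ := inv_entries g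
  have hden : den g⁻¹ α = ell α v := by
    simp only [den, i10, i11, g10, g00, ell, Int.cast_neg]
    ring
  obtain ⟨x, hx⟩ := exists_maps (M := g⁻¹) (x := α) (by rw [hden]; exact hell.ne')
  have hx' := hx.of_inv
  have hdx : den g x = (ell α v)⁻¹ := by
    have := hx.inv_den
    rwa [inv_inv, hden] at this
  have hy : (-(s : ℝ) / v 1 - t) * v 1 = -((s + t * v 1 : ℤ) : ℝ) := by
    push_cast
    field_simp
    ring
  have hfr : Frame α g x (-(s : ℝ) / v 1 - t) := by
    refine ⟨by rw [g10]; exact hqR, hx', by rw [hdx]; exact inv_pos.2 hell, ?_⟩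
    rw [g10, g11]
    exact hy
  refine ⟨g, x, -(s : ℝ) / v 1 - t, hfr, g10, ?_, ?_, ?_⟩
  · exact sub_nonneg.2 (Int.floor_le _)
  · linarith [Int.lt_floor_add_one (-(s : ℝ) / v 1)]
  · have := hfr.sub_mul
    rw [hdx, g10] at this
    rw [mul_inv, ← this, mul_comm, mul_assoc, mul_inv_cancel₀ hqR.ne', mul_one]

/-! ### The limit of the frames of an attainable number -/

section

variable {α a b : ℝ}

/-- Removing a common factor `d ≥ 2` divides the value by at least 4, which `h1` excludes for large
reduced denominators. Fractions with bounded reduced denominator stay away from the irrational `α`,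
so they fail once `v 1` is large. -/
lemma exists_coprime (hα : Irrational α) (ha : 1 ≤ a)
    (h1 : ∀ c < a⁻¹, ∃ Q : ℝ, ∀ v : Fin 2 → ℤ, Q ≤ |(v 1 : ℝ)| → c ≤ |(v 1 : ℝ)| * |ell α v|)
    (h2 : ∀ Q : ℝ, ∃ v : Fin 2 → ℤ, Q ≤ v 1 ∧ 0 < ell α v ∧ v 1 * ell α v ≤ a⁻¹) (Q : ℝ) :
    ∃ v : Fin 2 → ℤ, IsCoprime (v 0) (v 1) ∧ Q ≤ v 1 ∧ 0 < v 1 ∧ 0 < ell α v ∧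
      v 1 * ell α v ≤ a⁻¹ := by
  have hainv : 0 < a⁻¹ := by positivity
  have hainv1 : a⁻¹ ≤ 1 := inv_le_one_of_one_le₀ ha
  obtain ⟨Q1, hQ1⟩ := h1 (a⁻¹ / 2) (by linarith)
  obtain ⟨n, hn⟩ := exists_nat_gt Q1
  obtain ⟨η, hη, hball⟩ := Metric.eventually_nhds_iff.1
    (hα.eventually_forall_le_dist_cast_div_of_denom_le n)
  have hsep := hball (y := η / 2) (by
    rw [dist_zero_right, Real.norm_of_nonneg (by positivity)]; linarith)
  obtain ⟨v, hvQ, hv0, hv⟩ := h2 (max Q (2 / η + 1))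
  have hvQ1 : Q ≤ v 1 := (le_max_left _ _).trans hvQ
  have hvQ2 : 2 / η + 1 ≤ v 1 := (le_max_right _ _).trans hvQ
  have hη2 : 0 < 2 / η := by positivity
  have hq1 : (1 : ℝ) ≤ v 1 := by linarith
  have hq0 : (0 : ℝ) < v 1 := by linarith
  have hq : 0 < v 1 := by exact_mod_cast hq0
  refine ⟨v, ?_, hvQ1, hq, hv0, hv⟩
  rw [Int.isCoprime_iff_gcd_eq_one]
  by_contra hg
  have hg0 : 0 < Int.gcd (v 0) (v 1) := Int.gcd_pos_of_ne_zero_right _ hq.ne'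
  obtain ⟨p', hp'⟩ := Int.gcd_dvd_left (v 0) (v 1)
  obtain ⟨q', hq'⟩ := Int.gcd_dvd_right (v 0) (v 1)
  set d := Int.gcd (v 0) (v 1)
  have hd2 : (2 : ℝ) ≤ d := by exact_mod_cast (by omega : 2 ≤ d)
  have hpR : (v 0 : ℝ) = d * p' := by exact_mod_cast hp'
  have hqR : (v 1 : ℝ) = d * q' := by exact_mod_cast hq'
  have hq'0 : (0 : ℝ) < q' := by
    by_contra hc
    push Not at hc
    nlinarith
  have hell : ell α v = d * ell α ![p', q'] := by
    simp only [ell, Matrix.cons_val_zero, Matrix.cons_val_one, hpR, hqR]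
    ring
  have hell' : 0 < ell α ![p', q'] := by
    by_contra hc
    push Not at hc
    nlinarith
  rcases le_or_gt Q1 (q' : ℝ) with hc | hc
  · have hv1 : (![p', q'] : Fin 2 → ℤ) 1 = q' := rfl
    have h3 := hQ1 ![p', q'] (by rwa [hv1, abs_of_pos hq'0])
    rw [hv1, abs_of_pos hq'0, abs_of_pos hell'] at h3
    rw [hell, hqR] at hv
    have h4 : 4 * ((q' : ℝ) * ell α ![p', q']) ≤ d * q' * (d * ell α ![p', q']) := by
      have : (4 : ℝ) ≤ d * d := by nlinarith
      nlinarith [mul_pos hq'0 hell']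
    linarith
  · have hq'Z : 0 < q' := by exact_mod_cast hq'0
    have hle : q'.toNat ≤ n := by
      have : (q' : ℝ) < n := by linarith
      have : q' < n := by exact_mod_cast this
      omega
    have h3 := hsep q'.toNat hle p'
    have hcast : ((q'.toNat : ℕ) : ℝ) = q' := by
      exact_mod_cast congrArg (fun z : ℤ => (z : ℝ)) (Int.toNat_of_nonneg hq'Z.le)
    rw [hcast, Real.dist_eq] at h3
    have e : α - p' / q' = -(ell α v / v 1) := by
      rw [hell, hqR]
      simp only [ell, Matrix.cons_val_zero, Matrix.cons_val_one]
      field_simp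
      ring
    rw [e, abs_neg, abs_of_pos (by positivity), le_div_iff₀ hq0] at h3
    have h4 : ell α v ≤ 1 := by nlinarith
    have h5 : 2 < v 1 * η := by
      have : 2 / η < v 1 := by linarith
      rwa [div_lt_iff₀ hη] at this
    linarith

lemma exists_pow_bound {δ : ℝ} (hδ : 0 < δ) :
    ∃ δ₁ : ℝ, 0 < δ₁ ∧ δ₁ ≤ 1 / 100 ∧ 2 * δ₁ ≤ δ ∧ (1 + 50 * δ₁) ^ 4 ≤ 1 + δ := by
  have hc : Tendsto (fun d : ℝ => (1 + 50 * d) ^ 4) (nhds 0) (nhds ((1 + 50 * 0) ^ 4)) := by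
    apply Continuous.tendsto
    fun_prop
  have h1 := hc.eventually (gt_mem_nhds (by linarith : (1 + 50 * (0 : ℝ)) ^ 4 < 1 + δ))
  obtain ⟨η, hη, hball⟩ := Metric.eventually_nhds_iff.1 h1
  refine ⟨min (η / 2) (min (1 / 100) (δ / 2)), by positivity,
    (min_le_right _ _).trans (min_le_left _ _), ?_, (hball ?_).le⟩
  · linarith [(min_le_right (η / 2) (min (1 / 100) (δ / 2))).trans (min_le_right _ _)]
  · rw [dist_zero_right, Real.norm_of_nonneg (by positivity)]
    exact (min_le_left _ _).trans_lt (by linarith)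

/-- Returning segments of the orbit of `α` are shadowed by closed orbits. -/
lemma Frame.exists_closed {xb yb δ δ₁ : ℝ} (hbase : 1 ≤ xb - yb) (hδ : 0 < δ) (hδ₁ : 0 < δ₁)
    (hδ₁' : δ₁ ≤ 1 / 100) (h2δ : 2 * δ₁ ≤ δ) (hpow : (1 + 50 * δ₁) ^ 4 ≤ 1 + δ) {Q : ℝ}
    (hQ : ∀ v : Fin 2 → ℤ, Q ≤ |(v 1 : ℝ)| →
      ((xb - yb) * (1 + δ₁))⁻¹ ≤ |(v 1 : ℝ)| * |ell α v|)
    {g h : SLZ} {x y x' y' : ℝ} (hg : Frame α g x y) (hh : Frame α h x' y')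
    (hx : |x - xb| ≤ δ₁) (hy : |y - yb| ≤ δ₁) (hx' : |x' - xb| ≤ δ₁) (hy' : |y' - yb| ≤ δ₁)
    (hgQ : 8 * Q ≤ g 1 0) (hw4 : 4 ≤ (h 1 0 / g 1 0 : ℝ))
    (hwδ : 2 ≤ δ * (h 1 0 / g 1 0 : ℝ)) :
    ∃ X Y, Closed xb yb δ (h⁻¹ * g) X Y := by
  have seg : Seg xb yb δ₁ (h⁻¹ * g) x y x' y' :=
    ⟨hbase, hg.maps_trans_x hh, hg.maps_trans_y hh, hx, hy, hx', hy'⟩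
  have hden := hg.den_trans (h := h)
  rw [← hden] at hw4 hwδ
  set w := den (h⁻¹ * g) y
  have hc : 0 < (xb - yb) * (1 + δ₁) := mul_pos (by linarith) (by linarith)
  have hxy : 0 < x - y := by
    have a1 := abs_le.1 hx
    have a2 := abs_le.1 hy
    linarith [a1.1, a2.2]
  obtain ⟨X, Y, hyp, hX, hY, hgood, hdY⟩ := seg.closing hδ₁' hw4 hc.le (by
    intro v hv hv8
    have h3 : Q ≤ |((act g v 1 : ℤ) : ℝ)| := by
      rw [hg.act_apply_one, abs_mul, abs_of_pos hg.q_pos]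
      have h4 : 1 / 8 ≤ |ell y v| := by
        by_cases h0 : v 1 = 0
        · have hv0 : v 0 ≠ 0 := by
            intro h00
            apply hv
            funext i
            fin_cases i
            · exact h00
            · exact h0
          have : (1 : ℝ) ≤ |(v 0 : ℝ)| := by exact_mod_cast Int.one_le_abs hv0
          simp only [ell, h0, Int.cast_zero, mul_zero, sub_zero]
          linarith
        · have : (1 : ℝ) ≤ |(v 1 : ℝ)| := by exact_mod_cast Int.one_le_abs h0
          linarith
      nlinarith [hg.q_pos]
    have h4 := hQ _ h3
    have h5 := hg.mul_abs v
    rw [inv_le_iff_one_le_mul₀ hc] at h4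
    rw [← h5]
    nlinarith [mul_le_mul_of_nonneg_left h4 hxy.le])
  have hw2 : 16 ≤ w ^ 2 := by nlinarith
  refine ⟨X, Y, hbase, hyp, ?_, ?_, by nlinarith, ?_⟩
  · have : 8 * δ₁ / w ^ 2 ≤ δ₁ := by
      rw [div_le_iff₀ (by positivity)]
      nlinarith
    refine (abs_sub_le _ x _).trans ?_
    linarith
  · have : 6 * δ₁ / w ^ 2 ≤ δ₁ := by
      rw [div_le_iff₀ (by positivity)]
      nlinarith
    refine (abs_sub_le _ y' _).trans ?_
    linarith
  · intro v hv
    refine (hgood v hv).trans (mul_le_mul_of_nonneg_right ?_ (by positivity))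
    rw [mul_assoc]
    refine mul_le_mul_of_nonneg_left ?_ (by linarith)
    refine le_trans ?_ hpow
    calc (1 + δ₁) * (1 + 50 * δ₁) ^ 3 ≤ (1 + 50 * δ₁) * (1 + 50 * δ₁) ^ 3 := by
          gcongr
          linarith
      _ = _ := by ring

/-- Compactness of the unit interval makes `y` converge along a subsequence. Widths are at least `a`
by `h2` and asymptotically at most `a` by `h1`, so `x` converges too, and growing denominators make
the transitions long. -/
lemma exists_closed_of_attained (hα : Irrational α) (ha : 1 ≤ a) (hab : a < b)
    (hgap : GapAt a b)
    (h1 : ∀ c < a⁻¹, ∃ Q : ℝ, ∀ v : Fin 2 → ℤ, Q ≤ |(v 1 : ℝ)| → c ≤ |(v 1 : ℝ)| * |ell α v|)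
    (h2 : ∀ Q : ℝ, ∃ v : Fin 2 → ℤ, Q ≤ v 1 ∧ 0 < ell α v ∧ v 1 * ell α v ≤ a⁻¹) :
    ∃ xb yb, xb - yb = a ∧ ∀ δ > 0, ∃ S, Closed xb yb δ S xb yb := by
  choose v hco hvQ hvpos hell hle using fun n : ℕ => exists_coprime hα ha h1 h2 n
  choose g x y hfr hg10 hy0 hy1 hxy using fun n : ℕ => exists_frame (hco n) (hvpos n) (hell n)
  obtain ⟨yb, -, φ, hφ, hyφ⟩ := (isCompact_Icc (a := (0 : ℝ)) (b := 1)).tendsto_subseq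
    (fun n => (⟨hy0 n, hy1 n⟩ : y n ∈ Set.Icc (0 : ℝ) 1))
  have ha0 : 0 < a := by linarith
  have hvR : ∀ n, (0 : ℝ) < v n 1 := fun n => by exact_mod_cast hvpos n
  have hlow : ∀ n, a ≤ x n - y n := by
    intro n
    rw [hxy n]
    exact le_inv_of_le_inv₀ (mul_pos (hvR n) (hell n)) (hle n)
  have hqtop : Tendsto (fun n => (v n 1 : ℝ)) atTop atTop :=
    tendsto_atTop_mono hvQ tendsto_natCast_atTop_atTop
  have hqtopφ : Tendsto (fun n => (v (φ n) 1 : ℝ)) atTop atTop := hqtop.comp hφ.tendsto_atTop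
  have hdiff : Tendsto (fun n => x n - y n) atTop (nhds a) := by
    rw [Metric.tendsto_nhds]
    intro ε hε
    obtain ⟨Q, hQ⟩ := h1 (a + ε / 2)⁻¹ (by
      apply inv_strictAnti₀ ha0
      linarith)
    filter_upwards [hqtop.eventually_ge_atTop Q] with n hn
    have h3 := hQ (v n) (by rwa [abs_of_pos (hvR n)])
    rw [abs_of_pos (hvR n), abs_of_pos (hell n)] at h3
    have h4 : x n - y n ≤ a + ε / 2 := by
      rw [hxy n]
      exact inv_le_of_inv_le₀ (by linarith) h3
    rw [Real.dist_eq, abs_of_nonneg (by linarith [hlow n])]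
    linarith
  have hxφ : Tendsto (x ∘ φ) atTop (nhds (yb + a)) := by
    have h3 := hyφ.add (hdiff.comp hφ.tendsto_atTop)
    refine h3.congr fun n => ?_
    simp
  refine ⟨yb + a, yb, by ring, fun δ hδ => ?_⟩
  have hba : yb + a - yb = a := by ring
  refine exists_closed_base (b := b) (x := x ∘ φ) (y := y ∘ φ) (by rwa [hba]) (by rwa [hba])
    (by rwa [hba]) hxφ hyφ (fun k => by rw [hba]; exact hlow _) (fun δ hδ => ?_) hδ
  obtain ⟨δ₁, hδ₁, hδ₁', h2δ, hpow⟩ := exists_pow_bound hδ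
  obtain ⟨Q, hQ⟩ := h1 (a * (1 + δ₁))⁻¹ (by
    apply inv_strictAnti₀ ha0
    nlinarith)
  have ex : ∀ᶠ k in atTop, |x (φ k) - (yb + a)| ≤ δ₁ :=
    (tendsto_iff_dist_tendsto_zero.1 hxφ).eventually (ge_mem_nhds hδ₁)
  have ey : ∀ᶠ k in atTop, |y (φ k) - yb| ≤ δ₁ :=
    (tendsto_iff_dist_tendsto_zero.1 hyφ).eventually (ge_mem_nhds hδ₁)
  filter_upwards [ex, ey, hqtopφ.eventually_ge_atTop (8 * Q)] with k hkx hky hkQ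
  have hdiv : Tendsto (fun l => (v (φ l) 1 / v (φ k) 1 : ℝ)) atTop atTop :=
    hqtopφ.atTop_div_const (hvR _)
  filter_upwards [ex, ey, hdiv.eventually_ge_atTop 4, hdiv.eventually_ge_atTop (2 / δ)]
    with l hlx hly hl4 hlδ
  rw [div_le_iff₀' hδ] at hlδ
  obtain ⟨X, Y, hcl⟩ := (hfr (φ k)).exists_closed (xb := yb + a) (yb := yb) (by rwa [hba]) hδ
    hδ₁ hδ₁' h2δ hpow (by rwa [hba]) (hfr (φ l)) hkx hky hlx hly (by rwa [hg10])
    (by rwa [hg10, hg10]) (by rwa [hg10, hg10])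
  exact ⟨_, X, Y, hcl, (hfr (φ k)).maps_trans_x (hfr (φ l)),
    (hfr (φ k)).maps_trans_y (hfr (φ l))⟩

end

/-! ### From admissible to quadratic -/

lemma ell_neg (x : ℝ) (v : Fin 2 → ℤ) : ell (-x) ![-v 0, v 1] = -ell x v := by
  simp [ell]
  ring

/-- The vector `(1, 0)` gives the form value 1, so the constant of `X` lies between `X - Y` and `c <
b`; being in the spectrum, it cannot exceed `a`. -/
lemma gapAt_of_isMaximalGap {a b : ℝ} (h : IsMaximalGap a b) : GapAt a b := by
  intro M X Y c hyp hYX hc hcb hg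
  have hD : |X - Y| = X - Y := abs_of_pos (sub_pos.2 hYX)
  obtain ⟨t, ht, htc, hle⟩ := hyp.exists_constant_between (c := c⁻¹) (inv_pos.2 hc)
    (fun v hv => by
      rw [hD, inv_mul_le_iff₀ hc]
      exact hg v hv) (v := ![1, 0]) (by simp)
  simp only [ell, Matrix.cons_val_zero, Matrix.cons_val_one, Int.cast_one, Int.cast_zero,
    mul_zero, sub_zero, mul_one, abs_one, div_one, hD, inv_inv,
    Matrix.cons_val_fin_one] at hle htc
  refine hle.trans ?_
  by_contra hat
  push Not at hat
  have hmem : t ∈ Set.Ioo a b ∩ lagrangeSpectrum :=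
    ⟨⟨hat, htc.trans_lt hcb⟩, X, hyp.irrational, ht⟩
  rw [h.2.2.2] at hmem
  exact hmem

lemma exists_quadratic_of_closed {a b : ℝ} (h : IsMaximalGap a b) (ha : 1 ≤ a) {xb yb : ℝ}
    (hxy : xb - yb = a) (hcl : ∀ δ > 0, ∃ S, Closed xb yb δ S xb yb) :
    ∃ α : ℝ, IsQuadraticIrrationality α ∧ HasLagrangeConstant α a := by
  have hab := h.1
  obtain ⟨δ, hδ, hδb⟩ : ∃ δ > 0, a * (1 + δ) < b := by
    -- This choice puts `a(1 + δ)` at the midpoint of the gap.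
    refine ⟨(b - a) / (2 * a), div_pos (by linarith) (by linarith), ?_⟩
    have : a * (1 + (b - a) / (2 * a)) = (a + b) / 2 := by
      field_simp
      ring
    linarith
  obtain ⟨S, hS⟩ := hcl δ hδ
  have hD : |xb - yb| = a := by rw [hxy, abs_of_pos (by linarith)]
  have hc : 0 < a * (1 + δ) := mul_pos (by linarith) (by linarith)
  obtain ⟨t, ht, htc, hle⟩ := hS.hyp.exists_constant_between (c := (a * (1 + δ))⁻¹)
    (inv_pos.2 hc) (fun v hv => by
      have := hS.good v hv
      rw [hxy] at this
      rw [hD, inv_mul_le_iff₀ hc]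
      exact this) (v := ![1, 0]) (by simp)
  simp only [ell, Matrix.cons_val_zero, Matrix.cons_val_one, Int.cast_one, Int.cast_zero,
    mul_zero, sub_zero, mul_one, abs_one, div_one, hD, inv_inv,
    Matrix.cons_val_fin_one] at hle htc
  have hta : t = a := by
    refine le_antisymm ?_ hle
    by_contra hat
    push Not at hat
    have hmem : t ∈ Set.Ioo a b ∩ lagrangeSpectrum :=
      ⟨⟨hat, htc.trans_lt hδb⟩, xb, hS.hyp.irrational, ht⟩
    rw [h.2.2.2] at hmem
    exact hmem
  exact ⟨xb, hS.hyp.quadratic, hta ▸ ht⟩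

lemma HasLagrangeConstant.le_mul_abs_ell {α a : ℝ} (hα : Irrational α)
    (h : HasLagrangeConstant α a) {c : ℝ} (hc : c < a⁻¹) :
    ∃ Q : ℝ, ∀ v : Fin 2 → ℤ, Q ≤ |(v 1 : ℝ)| → c ≤ |(v 1 : ℝ)| * |ell α v| := by
  have hfin := HasLagrangeConstant.finite_lt hα h hc
  obtain ⟨n, hn⟩ := (hfin.image fun x => x.2).bddAbove
  refine ⟨(n : ℕ) + 1, fun v hv => ?_⟩
  have hv1 : v 1 ≠ 0 := by
    intro h0
    rw [h0] at hv
    have : (0 : ℝ) ≤ ((n : ℕ) : ℝ) := Nat.cast_nonneg _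
    norm_num at hv
    linarith
  obtain ⟨x, hx1, hx2⟩ := exists_pair α hv1
  rw [← hx2]
  by_contra hcon
  push Not at hcon
  have h3 : x.2 ≤ n := hn ⟨x, hcon, rfl⟩
  have h4 : ((x.2 : ℕ) : ℝ) ≤ ((n : ℕ) : ℝ) := by exact_mod_cast h3
  linarith

lemma exists_attained {α a : ℝ} (ha : 1 ≤ a) (h : {x | approxVal α x ≤ a⁻¹}.Infinite) (Q : ℝ) :
    ∃ v : Fin 2 → ℤ, Q ≤ v 1 ∧ 0 < v 1 ∧ v 1 * |ell α v| ≤ a⁻¹ := by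
  have hainv1 : a⁻¹ ≤ 1 := inv_le_one_of_one_le₀ ha
  by_contra hcon
  push Not at hcon
  refine h (finite_of_bounded (α := α) (K := 1) (Q := Q) fun x hx => ?_)
  have hx' : approxVal α x ≤ a⁻¹ := hx
  have hq : 0 < (x.2 : ℕ) := x.2.pos
  have hq1 : (1 : ℝ) ≤ ((x.2 : ℕ) : ℝ) := by exact_mod_cast hq
  rw [approxVal, abs_mul, abs_of_pos (by linarith)] at hx'
  constructor
  · by_contra hQ
    push Not at hQ
    have := hcon ![x.1, (x.2 : ℕ)] (by simpa using hQ.le) (by simp)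
    have e : |ell α ![x.1, (x.2 : ℕ)]| = |((x.2 : ℕ) : ℝ) * α - x.1| := by
      rw [← abs_neg]
      congr 1
      simp [ell]
      ring
    rw [e] at this
    simp only [Matrix.cons_val_one, Int.cast_natCast, Matrix.cons_val_fin_one] at this
    linarith
  · have := abs_nonneg (((x.2 : ℕ) : ℝ) * α - x.1)
    nlinarith

lemma exists_quadratic_of_isAdmissible {a b : ℝ} (hab : IsMaximalGap a b) (h : IsAdmissible a) :
    ∃ α : ℝ, IsQuadraticIrrationality α ∧ HasLagrangeConstant α a := by
  obtain ⟨α, ⟨hα, hatt⟩, hL⟩ := h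
  obtain ⟨ha, -⟩ := HasLagrangeConstant.liminf_eq hα hL
  simp only [HasLagrangeConstant.mem_attain_iff hα hL] at hatt
  have hgap := gapAt_of_isMaximalGap hab
  have h1 := fun c hc => HasLagrangeConstant.le_mul_abs_ell hα hL (c := c) hc
  have h2 := exists_attained ha hatt
  -- Frames use fractions to the right of `α`. If these do not recur, all attaining fractions with
  -- large denominator lie to the left, and reflection exchanges the sides.
  by_cases hpos : ∀ Q : ℝ, ∃ v : Fin 2 → ℤ, Q ≤ v 1 ∧ 0 < ell α v ∧ v 1 * ell α v ≤ a⁻¹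
  · obtain ⟨xb, yb, hxy, hcl⟩ := exists_closed_of_attained hα ha hab.1 hgap h1 hpos
    exact exists_quadratic_of_closed hab ha hxy hcl
  · push Not at hpos
    obtain ⟨Q₀, hQ₀⟩ := hpos
    obtain ⟨xb, yb, hxy, hcl⟩ := exists_closed_of_attained (α := -α) hα.neg ha hab.1 hgap
      (fun c hc => by
        obtain ⟨Q, hQ⟩ := h1 c hc
        refine ⟨Q, fun v hv => ?_⟩
        have := hQ ![-v 0, v 1] (by simpa using hv)
        have e : ell α ![-v 0, v 1] = - ell (-α) v := by
          simp [ell]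
          ring
        rw [e, abs_neg] at this
        simpa using this)
      (fun Q => by
        obtain ⟨v, hv1, hv0, hv⟩ := h2 (max Q Q₀)
        have hv0' : (0 : ℝ) < v 1 := by exact_mod_cast hv0
        have hvne : v ≠ 0 := fun h0 => by simp [h0] at hv0
        have hneg : ell α v < 0 := by
          by_contra hge
          push Not at hge
          have hgt := lt_of_le_of_ne hge (ell_ne_zero_of_irrational hα hvne).symm
          have := hQ₀ v ((le_max_right _ _).trans hv1) hgt
          rw [abs_of_pos hgt] at hv
          linarith
        rw [abs_of_neg hneg] at hv
        refine ⟨![-v 0, v 1], ?_, ?_, ?_⟩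
        · exact (le_max_left _ _).trans hv1
        · rw [ell_neg]
          linarith
        · rw [ell_neg]
          exact hv)
    exact exists_quadratic_of_closed hab ha hxy hcl

/-! ### From quadratic to admissible -/

/-- A quadratic irrationality is fixed by a hyperbolic element of the modular group, obtained from
a solution of Pell's equation. -/
lemma exists_hyp_of_quadratic {α : ℝ} (h : IsQuadraticIrrationality α) :
    ∃ M Y, Hyp M α Y := by
  obtain ⟨hα, A, B, C, hA, hf⟩ := h
  have hAR : (A : ℝ) ≠ 0 := by exact_mod_cast hA
  set s : ℝ := 2 * A * α + B with hs
  have hsq : s ^ 2 = ((B ^ 2 - 4 * A * C : ℤ) : ℝ) := by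
    push_cast
    rw [hs]
    linear_combination 4 * (A : ℝ) * hf
  have hrat : ∀ r : ℤ, s ≠ r := by
    intro r hr
    refine hα ⟨((r - B : ℤ) : ℚ) / ((2 * A : ℤ) : ℚ), ?_⟩
    push_cast
    rw [← hr, hs]
    field_simp
    ring
  have hs0 : s ≠ 0 := by simpa using hrat 0
  have hDpos : 0 < B ^ 2 - 4 * A * C := by
    have : (0 : ℝ) < ((B ^ 2 - 4 * A * C : ℤ) : ℝ) := by
      rw [← hsq]
      positivity
    exact_mod_cast this
  have hDsq : ¬ IsSquare (B ^ 2 - 4 * A * C) := by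
    rintro ⟨r, hr⟩
    rw [hr] at hsq
    push_cast at hsq
    have : (s - r) * (s + r) = 0 := by linear_combination hsq
    rcases mul_eq_zero.1 this with h0 | h0
    · exact hrat r (by linarith)
    · exact hrat (-r) (by push_cast; linarith)
  obtain ⟨t₀, u₀, hpell₀, hu₀⟩ := Pell.exists_of_not_isSquare hDpos hDsq
  -- The signs make the denominator `t - u s` at the conjugate root exceed 1, so `α` is the
  -- repelling point.
  obtain ⟨t, u, hpell, ht, hu⟩ : ∃ t u : ℤ, t ^ 2 - (B ^ 2 - 4 * A * C) * u ^ 2 = 1 ∧ 0 < t ∧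
      (u : ℝ) * s < 0 := by
    have ht₀ : t₀ ≠ 0 := by
      rintro rfl
      nlinarith [sq_nonneg u₀]
    have hus : (u₀ : ℝ) * s ≠ 0 := mul_ne_zero (by exact_mod_cast hu₀) hs0
    rcases lt_or_gt_of_ne hus with hlt | hgt
    · exact ⟨|t₀|, u₀, by rw [sq_abs]; exact hpell₀, abs_pos.2 ht₀, hlt⟩
    · refine ⟨|t₀|, -u₀, by rw [sq_abs, neg_sq]; exact hpell₀, abs_pos.2 ht₀, ?_⟩
      push_cast
      linarith
  let M : SLZ := ⟨!![t - B * u, -2 * C * u; 2 * A * u, t + B * u], by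
    rw [Matrix.det_fin_two_of]
    linear_combination hpell⟩
  have m00 : M 0 0 = t - B * u := rfl
  have m01 : M 0 1 = -2 * C * u := rfl
  have m10 : M 1 0 = 2 * A * u := rfl
  have m11 : M 1 1 = t + B * u := rfl
  have hpellR : (t : ℝ) ^ 2 - s ^ 2 * u ^ 2 = 1 := by
    rw [hsq]
    exact_mod_cast hpell
  have d1 : den M α = t + u * s := by
    simp only [den, m10, m11, hs]
    push_cast
    ring
  have d2 : den M (-B / A - α) = t - u * s := by
    simp only [den, m10, m11, hs]
    push_cast
    field_simp
    ring
  have htR : (1 : ℝ) ≤ t := by exact_mod_cast ht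
  have hprod : ((t : ℝ) + u * s) * (t - u * s) = 1 := by linear_combination hpellR
  refine ⟨M, -B / A - α, ⟨?_, ?_⟩, ⟨?_, ?_⟩, ?_, ?_⟩
  · rw [d1]
    exact left_ne_zero_of_mul_eq_one hprod
  · simp only [den, m00, m01, m10, m11]
    push_cast
    linear_combination (-2 * (u : ℝ)) * hf
  · rw [d2]
    exact right_ne_zero_of_mul_eq_one hprod
  · simp only [den, m00, m01, m10, m11]
    push_cast
    field_simp
    linear_combination (-2 * (u : ℝ) * A) * hf
  · rw [d2]
    linarith
  · intro h0
    apply hs0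
    rw [hs, mul_assoc, h0]
    field_simp
    have : (A : ℝ) * α = -B - A * α := by
      nth_rewrite 1 [h0]
      field_simp
    linarith

/-- The integral binary quadratic form whose roots are the fixed points of `M`. -/
def fixedForm (M : SLZ) (v : Fin 2 → ℤ) : ℤ :=
  M 1 0 * v 0 ^ 2 + (M 1 1 - M 0 0) * (v 0 * v 1) - M 0 1 * v 1 ^ 2

lemma Hyp.fixedForm_eq {M : SLZ} {X Y : ℝ} (h : Hyp M X Y) (v : Fin 2 → ℤ) :
    (fixedForm M v : ℝ) = M 1 0 * (ell X v * ell Y v) := by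
  obtain ⟨-, s, p⟩ := h.symm_relations
  simp only [fixedForm, ell]
  push_cast
  linear_combination (v 0 * v 1 : ℝ) * s - (v 1 : ℝ) ^ 2 * p

/-- The form of a hyperbolic element attains its least nonzero absolute value at a primitive
vector. -/
lemma Hyp.exists_min {M : SLZ} {X Y : ℝ} (h : Hyp M X Y) :
    ∃ v : Fin 2 → ℤ, IsCoprime (v 0) (v 1) ∧
      ∀ w : Fin 2 → ℤ, w ≠ 0 → |ell X v * ell Y v| ≤ |ell X w * ell Y w| := by
  classical
  -- The form takes integer values, so its least absolute value over nonzero vectors is attained; a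
  -- common factor `d` of the minimizer could be divided out, lowering the value by `d²`.
  have hex : ∃ n : ℕ, ∃ v : Fin 2 → ℤ, v ≠ 0 ∧ (fixedForm M v).natAbs = n :=
    ⟨_, ![1, 0], by simp, rfl⟩
  obtain ⟨v, hv, hvn⟩ := Nat.find_spec hex
  have hmin : ∀ w : Fin 2 → ℤ, w ≠ 0 → (fixedForm M v).natAbs ≤ (fixedForm M w).natAbs := by
    intro w hw
    rw [hvn]
    exact Nat.find_min' hex ⟨w, hw, rfl⟩
  have hK : 0 < |(M 1 0 : ℝ)| := abs_pos.2 h.symm_relations.1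
  have hne : ∀ w : Fin 2 → ℤ, w ≠ 0 → fixedForm M w ≠ 0 := by
    intro w hw h0
    have := h.fixedForm_eq w
    rw [h0, Int.cast_zero] at this
    exact mul_ne_zero h.symm_relations.1
      (mul_ne_zero (h.ellX_ne_zero hw) (h.ellY_ne_zero hw)) this.symm
  refine ⟨v, ?_, fun w hw => ?_⟩
  · rw [Int.isCoprime_iff_gcd_eq_one]
    by_contra hg
    obtain ⟨p', hp'⟩ := Int.gcd_dvd_left (v 0) (v 1)
    obtain ⟨q', hq'⟩ := Int.gcd_dvd_right (v 0) (v 1)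
    have hg0 : Int.gcd (v 0) (v 1) ≠ 0 := by
      intro h0
      rw [Int.gcd_eq_zero_iff] at h0
      apply hv
      funext i
      fin_cases i
      · exact h0.1
      · exact h0.2
    set d := Int.gcd (v 0) (v 1)
    have hv' : ![p', q'] ≠ 0 := by
      intro h0
      have e0 : p' = 0 := congrFun h0 0
      have e1 : q' = 0 := congrFun h0 1
      rw [e0, mul_zero] at hp'
      rw [e1, mul_zero] at hq'
      apply hv
      funext i
      fin_cases i
      · exact hp'
      · exact hq'
    have e : fixedForm M v = (d : ℤ) ^ 2 * fixedForm M ![p', q'] := by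
      simp only [fixedForm, Matrix.cons_val_zero, Matrix.cons_val_one, Matrix.cons_val_fin_one]
      rw [hp', hq']
      ring
    have h1 := hmin _ hv'
    have h2 : 0 < (fixedForm M ![p', q']).natAbs := Int.natAbs_pos.2 (hne _ hv')
    rw [e, Int.natAbs_mul, Int.natAbs_pow, Int.natAbs_natCast] at h1
    have h3 : 2 ≤ d := by omega
    have h4 : 4 ≤ d ^ 2 := by nlinarith
    nlinarith
  · have h1 : |fixedForm M v| ≤ |fixedForm M w| := by
      have := hmin w hw
      rw [Int.abs_eq_natAbs, Int.abs_eq_natAbs]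
      exact_mod_cast this
    have h2 : |(fixedForm M v : ℝ)| ≤ |(fixedForm M w : ℝ)| := by exact_mod_cast h1
    rw [h.fixedForm_eq, h.fixedForm_eq, abs_mul, abs_mul (M 1 0 : ℝ)] at h2
    exact le_of_mul_le_mul_left h2 hK

lemma Hyp.conj {M g : SLZ} {X Y X' Y' : ℝ} (h : Hyp M X Y) (hX : Maps g X X')
    (hY : Maps g Y Y') : Hyp (g * M * g⁻¹) X' Y' := by
  refine ⟨hX.inv.mul (h.mapsX.mul hX), hY.inv.mul (h.mapsY.mul hY), ?_, fun h0 => ?_⟩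
  · rw [hY.inv.mul_den, h.mapsY.mul_den, hY.inv_den]
    have := hY.1
    have e : den g Y * den M Y * (den g Y)⁻¹ = den M Y := by field_simp
    rw [e]
    exact h.one_lt
  · have := hX.sub hY
    rw [h0, sub_self, zero_mul] at this
    exact h.ne (sub_eq_zero.1 this.symm)

/-- Moving a minimizing vector to `(1, 0)` replaces `α` by an equivalent number with the same
constant `|X' - Y'|`. The product of linear forms there is 1, positive whatever the sign at `v`, so
`Hyp.infinite_approxVal_le_of_pos` applies. -/
lemma isAdmissible_of_quadratic {α a : ℝ} (hq : IsQuadraticIrrationality α)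
    (hL : HasLagrangeConstant α a) : IsAdmissible a := by
  obtain ⟨M, Y, h⟩ := exists_hyp_of_quadratic hq
  obtain ⟨v, hco, hmin⟩ := h.exists_min
  obtain ⟨g, hg0, hg1⟩ := hco.exists_SL2_col 0
  have hv : v ≠ 0 := by
    rintro rfl
    exact not_isCoprime_zero_zero hco
  have hdeninv : ∀ z, den g⁻¹ z = ell z v := by
    intro z
    obtain ⟨-, -, i10, i11⟩ := inv_entries g
    simp only [den, ell, i10, i11, hg0, hg1, Int.cast_neg]
    ring
  have hX0 := h.ellX_ne_zero hv
  have hY0 := h.ellY_ne_zero hv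
  obtain ⟨X', hX'⟩ := exists_maps (M := g⁻¹) (x := α) (by rwa [hdeninv])
  obtain ⟨Y', hY'⟩ := exists_maps (M := g⁻¹) (x := Y) (by rwa [hdeninv])
  have h' := h.conj hX' hY'
  have hm : 0 < |ell α v * ell Y v| := abs_pos.2 (mul_ne_zero hX0 hY0)
  have hsub : |X' - Y'| * |ell α v * ell Y v| = |α - Y| := by
    rw [← hX'.sub hY', hdeninv, hdeninv, abs_mul (X' - Y')]
  have hD : 0 < |α - Y| := abs_pos.2 (sub_ne_zero.2 h.ne)
  have hD' : 0 < |X' - Y'| := abs_pos.2 (sub_ne_zero.2 h'.ne)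
  have hlow' : ∀ w : Fin 2 → ℤ, w ≠ 0 →
      |X' - Y'|⁻¹ * |X' - Y'| ≤ |ell X' w| * |ell Y' w| := by
    intro w hw
    rw [inv_mul_cancel₀ hD'.ne', ← abs_mul]
    have h1 := hmin (act g w) (act_ne_zero g hw)
    have e1 := hX'.ell_act (act g w)
    have e2 := hY'.ell_act (act g w)
    rw [act_inv_act, hdeninv] at e1 e2
    rw [← e1, ← e2] at h1
    have e3 : |ell X' w * ell α v * (ell Y' w * ell Y v)| =
        |ell X' w * ell Y' w| * |ell α v * ell Y v| := by
      rw [← abs_mul]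
      congr 1
      ring
    rw [e3] at h1
    exact (le_mul_iff_one_le_left hm).1 h1
  obtain ⟨t, ht, ht1, ht2⟩ := h'.exists_constant_between (inv_pos.2 hD') hlow'
    (v := ![1, 0]) (by simp)
  obtain ⟨t₀, ht₀, ht₀1, ht₀2⟩ := h.exists_constant_between
    (c := |ell α v * ell Y v| / |α - Y|) (by positivity) (fun w hw => by
      rw [div_mul_cancel₀ _ hD.ne', ← abs_mul]
      exact hmin w hw) hv
  have e10 : ∀ z : ℝ, ell z ![1, 0] = 1 := fun z => by simp [ell]
  rw [e10, e10, mul_one, abs_one, div_one] at ht2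
  rw [inv_inv] at ht1
  rw [inv_div] at ht₀1
  have hta : t = |X' - Y'| := le_antisymm ht1 ht2
  have hat : a = |X' - Y'| := by
    rw [HasLagrangeConstant.unique hL ht₀, le_antisymm ht₀1 ht₀2, ← hsub]
    field_simp
  rw [hta, ← hat] at ht
  have hirr := h'.irrational
  refine ⟨X', ⟨hirr, ?_⟩, ht⟩
  simp only [HasLagrangeConstant.mem_attain_iff hirr ht]
  have := h'.infinite_approxVal_le_of_pos (v := ![1, 0]) (by rw [e10, e10]; norm_num)
  rwa [e10, e10, mul_one, one_div, ← hat] at this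

end LagrangeGap

theorem theorem2 (a : ℝ) (ha : ∃ b : ℝ, IsMaximalGap a b) :
    IsAdmissible a ↔ ∃ α : ℝ, IsQuadraticIrrationality α ∧ HasLagrangeConstant α a := by
  obtain ⟨b, hab⟩ := ha
  refine ⟨LagrangeGap.exists_quadratic_of_isAdmissible hab, ?_⟩
  rintro ⟨α, hq, hL⟩
  exact LagrangeGap.isAdmissible_of_quadratic hq hL
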